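/- **Non-Garbage Critical Pair Lemma (rooted graph transformation with relabelling).** *Graphs.* Fix a label alphabet $\mathcal L=(\mathcal L_V,\mathcal L_E)$ of finite sets. A *graph* is $G=(V,E,s,t,l,m,p)$ with $V,E$ finite sets, total functions $s,t:E\to V$ and $m:E\to\mathcal L_E$, and partial functions $l:V\rightharpoonup\mathcal L_V$ (node labels) and $p:V\rightharpoonup\mathbb Z_2$ (rootedness). It is a *TLRG* if $l$ and $p$ are total. A *morphism* is a pair of functions on nodes and edges preserving sources, targets, edge labels, and node labels and rootedness wherever these are defined; it is *undefinedness preserving* if $l_G=l_H\circ g_V$ and $p_G=p_H\circ g_V$. Isomorphisms are morphisms with an inverse morphism; $[G]$ is the isomorphism class of $G$, and $\mathcal G^{\oplus}(\mathcal L)$ is the collection of all $[G]$ with $G$ a TLRG. *Systems.* A *rule* $r=\langle L\leftarrow K\to R\rangle$ consists of TLRGs $L,R$, a graph $K$ and inclusions (injective morphisms) $K\to L$, $K\to R$. A *match* of $r$ in a TLRG $G$ is an injective morphism $g:L\to G$ such that no edge of $G\setminus g(L)$ is incident to a node of $g(L\setminus K)$. The rule is applied by (1) deleting $g(L\setminus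 K)$ from $G$ and making the label (rootedness) of $g(v)$ undefined for each node $v$ of $K$ whose label (rootedness) is undefined, and (2) disjointly adding $R\setminus K$ with its labels and rootedness, and giving $g(v)$ the label $l_R(v)$ (rootedness $p_R(v)$) for each node $v$ of $K$ whose label (rootedness) is undefined. We write $G\Rightarrow_{r,g}M$, a *direct derivation*, if $M$ is isomorphic to the result. Its *track* is the induced partial map from the nodes of $G$ to those of $M$, defined exactly on the nodes that are not deleted. A *GT system* $T=(\mathcal L,\mathcal R)$ has a finite set $\mathcal R$ of rules; $\Rightarrow_{\mathcal R}$ is direct derivation by some rule of $\mathcal R$, and a derivation $G\Rightarrow^*_{\mathcal R}M$ is an isomorphism $G\cong M$ or a finite sequence of direct derivations, whose track is the composition of the isomorphism or of the tracks of the steps. TLRGs $H_1,H_2$ are *joinable* if $H_1\Rightarrow^*_{\mathcal R}M\Leftarrow^*_{\mathcal R}H_2$ for some TLRG $M$. *Critical pairs.* A pair of direct derivations $H_1\Leftarrow_{r_1,g_1}G\Rightarrow_{r_2,g_2}H_2$ with $r_1,r_2\in\mathcal R$ is *parallelly independent* if $g_1(L_1)\cap g_2(L_2)\subseteq g_1(K_1)\cap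 g_2(K_2)$. Here images, intersections and inclusions are those of graphs with partial functions treated as sets, so that a node common to both matches must also have its label and its rootedness defined in both interfaces. The pair is *critical* if $G=g_1(L_1)\cup g_2(L_2)$, it is not parallelly independent, and $g_1\ne g_2$ in case $r_1=r_2$. Its *persistent* nodes are the nodes of $G$ deleted by neither step. It is *strongly joinable* if there are a TLRG $M$ and derivations $H_1\Rightarrow^*_{\mathcal R}M\Leftarrow^*_{\mathcal R}H_2$ such that for each persistent node $v$ the tracks of $G\Rightarrow H_1\Rightarrow^*M$ and of $G\Rightarrow H_2\Rightarrow^*M$ are both defined at $v$ and equal there. *Garbage.* Let $\mathbf D\subseteq\mathcal G^{\oplus}(\mathcal L)$. Its *subgraph closure* $\overline{\mathbf D}$ is the smallest set $\mathbf S\supseteq\mathbf D$ such that $[G]\in\mathbf S$ implies $[H]\in\mathbf S$ for all TLRGs $H\subseteq G$ (with undefinedness preserving inclusion). A critical pair $H_1\Leftarrow G\Rightarrow H_2$ is *non-garbage* with respect to $\mathbf D$ if $[G]\in\overline{\mathbf D}$. The system $T$ is *locally confluent on* $\mathbf D$ if $H_1,H_2$ are joinable whenever $H_1\Leftarrow_{\mathcal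 R}G\Rightarrow_{\mathcal R}H_2$ with $G,H_1,H_2$ TLRGs and $[G]\in\mathbf D$. **Theorem.** Let $T=(\mathcal L,\mathcal R)$ be a GT system as above and $\mathbf D\subseteq\mathcal G^{\oplus}(\mathcal L)$. If all critical pairs of $T$ that are non-garbage with respect to $\mathbf D$ are strongly joinable, then $T$ is locally confluent on $\mathbf D$. -/

import Mathlib

universe u v w

namespace RGT

/-- A label alphabet: finite sets of node labels and of edge labels. -/
structure LabelAlphabet where
  NodeLabel : Type u
  EdgeLabel : Type v
  finite_nodeLabel : Finite NodeLabel
  finite_edgeLabel : Finite EdgeLabel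

/-- A (partially labelled, partially rooted) finite directed graph over `𝓛`. Partial functions
are functions into `Option`; rootedness `1` means rooted, `0` unrooted. -/
structure PLRG (𝓛 : LabelAlphabet.{u, v}) where
  V : Type w
  E : Type w
  finite_V : Finite V
  finite_E : Finite E
  s : E → V
  t : E → V
  l : V → Option 𝓛.NodeLabel
  m : E → 𝓛.EdgeLabel
  p : V → Option (ZMod 2)

variable {𝓛 : LabelAlphabet.{u, v}}

/-- Totally labelled and totally rooted. -/
def PLRG.IsTLRG (G : PLRG.{u, v, w} 𝓛) : Prop :=
  (∀ x, (G.l x).isSome) ∧ (∀ x, (G.p x).isSome)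

/-- Graph morphisms: labels and rootedness are preserved where they are defined. -/
@[ext]
structure Hom (G H : PLRG.{u, v, w} 𝓛) where
  V : G.V → H.V
  E : G.E → H.E
  source : ∀ e, V (G.s e) = H.s (E e)
  target : ∀ e, V (G.t e) = H.t (E e)
  edgeLabel : ∀ e, G.m e = H.m (E e)
  nodeLabel : ∀ x a, G.l x = some a → H.l (V x) = some a
  rootedness : ∀ x b, G.p x = some b → H.p (V x) = some b

namespace Hom

def id (G : PLRG.{u, v, w} 𝓛) : Hom G G where
  V := fun x => x
  E := fun e => e
  source _ := rfl
  target _ := rfl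
  edgeLabel _ := rfl
  nodeLabel _ _ h := h
  rootedness _ _ h := h

def comp {G H M : PLRG.{u, v, w} 𝓛} (g : Hom H M) (f : Hom G H) : Hom G M where
  V := fun x => g.V (f.V x)
  E := fun e => g.E (f.E e)
  source e := by rw [f.source, g.source]
  target e := by rw [f.target, g.target]
  edgeLabel e := by rw [f.edgeLabel, g.edgeLabel]
  nodeLabel x a h := g.nodeLabel _ _ (f.nodeLabel _ _ h)
  rootedness x b h := g.rootedness _ _ (f.rootedness _ _ h)

def Injective {G H : PLRG.{u, v, w} 𝓛} (f : Hom G H) : Prop :=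
  Function.Injective f.V ∧ Function.Injective f.E

def UndefinednessPreserving {G H : PLRG.{u, v, w} 𝓛} (f : Hom G H) : Prop :=
  (∀ x, G.l x = H.l (f.V x)) ∧ (∀ x, G.p x = H.p (f.V x))

end Hom

/-- Isomorphisms: morphisms with an inverse morphism. -/
structure Iso (G H : PLRG.{u, v, w} 𝓛) where
  hom : Hom G H
  inv : Hom H G
  hom_inv : inv.comp hom = Hom.id G
  inv_hom : hom.comp inv = Hom.id H

namespace Iso

def refl (G : PLRG.{u, v, w} 𝓛) : Iso G G := ⟨Hom.id G, Hom.id G, rfl, rfl⟩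

def symm {G H : PLRG.{u, v, w} 𝓛} (f : Iso G H) : Iso H G :=
  ⟨f.inv, f.hom, f.inv_hom, f.hom_inv⟩

def trans {G H M : PLRG.{u, v, w} 𝓛} (f : Iso G H) (g : Iso H M) : Iso G M where
  hom := g.hom.comp f.hom
  inv := f.inv.comp g.inv
  hom_inv := by
    change f.inv.comp ((g.inv.comp g.hom).comp f.hom) = Hom.id G
    rw [g.hom_inv]; exact f.hom_inv
  inv_hom := by
    change g.hom.comp ((f.hom.comp f.inv).comp g.inv) = Hom.id M
    rw [f.inv_hom]; exact g.inv_hom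

end Iso

/-- Totally labelled, totally rooted graphs. -/
abbrev TLRG (𝓛 : LabelAlphabet.{u, v}) := {G : PLRG.{u, v, w} 𝓛 // G.IsTLRG}

/-- Isomorphism as an equivalence relation on totally labelled, totally rooted graphs. -/
instance isoSetoid (𝓛 : LabelAlphabet.{u, v}) : Setoid (TLRG.{u, v, w} 𝓛) where
  r G H := Nonempty (Iso G.1 H.1)
  iseqv :=
    { refl := fun G => ⟨Iso.refl G.1⟩
      symm := fun ⟨f⟩ => ⟨f.symm⟩
      trans := fun ⟨f⟩ ⟨g⟩ => ⟨f.trans g⟩ }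

/-- Abstract totally labelled, totally rooted graphs, i.e. isomorphism classes. -/
def AbstractTLRG (𝓛 : LabelAlphabet.{u, v}) := Quotient (isoSetoid.{u, v, w} 𝓛)

/-- The isomorphism class `[G]`. -/
def TLRG.cls (G : TLRG.{u, v, w} 𝓛) : AbstractTLRG.{u, v, w} 𝓛 :=
  Quotient.mk (isoSetoid 𝓛) G

/-! ### Parts of a graph, with labels and rootedness counted -/

/-- The items of which (the tuple describing) a graph is made up. Here `label x` and `root x`
stand for the pairs `(x, l x)` and `(x, p x)` in the graphs of the partial functions `l`, `p`. -/
inductive Item (G : PLRG.{u, v, w} 𝓛) where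
  | node (x : G.V)
  | edge (e : G.E)
  | label (x : G.V)
  | root (x : G.V)

/-- The image `f(G)` of a graph under a morphism `f : G → H`, as a part of `H`. The label of a node
`f x` belongs to `f(G)` iff it comes from a label of a node in `G`; same for rootedness. -/
def Hom.image {G H : PLRG.{u, v, w} 𝓛} (f : Hom G H) : Set (Item H) :=
  {i | (∃ x, i = Item.node (f.V x)) ∨ (∃ e, i = Item.edge (f.E e)) ∨
    (∃ x, (G.l x).isSome ∧ i = Item.label (f.V x)) ∨
    (∃ x, (G.p x).isSome ∧ i = Item.root (f.V x))}

/-- A graph as a part of itself. -/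
def PLRG.items (G : PLRG.{u, v, w} 𝓛) : Set (Item G) := (Hom.id G).image

/-! ### Subgraph closure -/

/-- `H` is, up to isomorphism, a subgraph of `G`, where the inclusion is required to be
undefinedness preserving. -/
def IsSubgraph (H G : PLRG.{u, v, w} 𝓛) : Prop :=
  ∃ i : Hom H G, i.Injective ∧ i.UndefinednessPreserving

def SubgraphClosed (D : Set (AbstractTLRG.{u, v, w} 𝓛)) : Prop :=
  ∀ G H : TLRG.{u, v, w} 𝓛, IsSubgraph H.1 G.1 → G.cls ∈ D → H.cls ∈ D

/-- The smallest subgraph closed set containing `D`. -/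
def subgraphClosure (D : Set (AbstractTLRG.{u, v, w} 𝓛)) : Set (AbstractTLRG.{u, v, w} 𝓛) :=
  ⋂₀ {S | D ⊆ S ∧ SubgraphClosed S}

/-! ### Rules and their application -/

/-- A rule `⟨L ← K → R⟩`; the inclusions of the interface are given as injective morphisms. -/
structure Rule (𝓛 : LabelAlphabet.{u, v}) where
  L : TLRG.{u, v, w} 𝓛
  K : PLRG.{u, v, w} 𝓛
  R : TLRG.{u, v, w} 𝓛
  inL : Hom K L.1
  inR : Hom K R.1
  inL_injective : inL.Injective
  inR_injective : inR.Injective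

/-- An injective morphism from the left-hand side that satisfies the dangling condition: no edge
outside `g(L)` is incident to a node in `g(L \ K)`. -/
structure Match (r : Rule.{u, v, w} 𝓛) (G : TLRG.{u, v, w} 𝓛) where
  g : Hom r.L.1 G.1
  injective : g.Injective
  dangling : ∀ e : G.1.E, e ∉ Set.range g.E → ∀ x : r.L.1.V, x ∉ Set.range r.inL.V →
    G.1.s e ≠ g.V x ∧ G.1.t e ≠ g.V x

namespace Match

variable {r : Rule.{u, v, w} 𝓛} {G : TLRG.{u, v, w} 𝓛} (μ : Match r G)

/-- The nodes in `g(L \ K)`. -/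
def deletedV : Set G.1.V := {y | ∃ x, x ∉ Set.range r.inL.V ∧ μ.g.V x = y}

/-- The edges in `g(L \ K)`. -/
def deletedE : Set G.1.E := {y | ∃ x, x ∉ Set.range r.inL.E ∧ μ.g.E x = y}

/-- The morphism `K → L → G`. -/
def interface : Hom r.K G.1 := μ.g.comp r.inL

theorem interface_not_deleted (k : r.K.V) : μ.interface.V k ∉ μ.deletedV := by
  rintro ⟨x, hx, h⟩
  exact hx ⟨k, (μ.injective.1 h).symm⟩

theorem source_not_deleted (e : G.1.E) (he : e ∉ μ.deletedE) : G.1.s e ∉ μ.deletedV := by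
  rintro ⟨x, hx, h⟩
  by_cases hr : e ∈ Set.range μ.g.E
  · obtain ⟨f, rfl⟩ := hr
    by_cases hf : f ∈ Set.range r.inL.E
    · obtain ⟨k, rfl⟩ := hf
      rw [← μ.g.source, ← r.inL.source] at h
      exact hx ⟨_, (μ.injective.1 h).symm⟩
    · exact he ⟨f, hf, rfl⟩
  · exact (μ.dangling e hr x hx).1 h.symm

theorem target_not_deleted (e : G.1.E) (he : e ∉ μ.deletedE) : G.1.t e ∉ μ.deletedV := by
  rintro ⟨x, hx, h⟩
  by_cases hr : e ∈ Set.range μ.g.E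
  · obtain ⟨f, rfl⟩ := hr
    by_cases hf : f ∈ Set.range r.inL.E
    · obtain ⟨k, rfl⟩ := hf
      rw [← μ.g.target, ← r.inL.target] at h
      exact hx ⟨_, (μ.injective.1 h).symm⟩
    · exact he ⟨f, hf, rfl⟩
  · exact (μ.dangling e hr x hx).2 h.symm

open Classical in
/-- The intermediate graph: `g(L \ K)` is deleted, and images of unlabelled nodes of `K` are made
unlabelled, images of nodes of `K` with undefined rootedness get undefined rootedness. -/
noncomputable def intermediate : PLRG.{u, v, w} 𝓛 where
  V := {y : G.1.V // y ∉ μ.deletedV}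
  E := {e : G.1.E // e ∉ μ.deletedE}
  finite_V := haveI := G.1.finite_V; inferInstance
  finite_E := haveI := G.1.finite_E; inferInstance
  s e := ⟨G.1.s e.1, μ.source_not_deleted e.1 e.2⟩
  t e := ⟨G.1.t e.1, μ.target_not_deleted e.1 e.2⟩
  l y := if ∃ k, r.K.l k = none ∧ μ.interface.V k = y.1 then none else G.1.l y.1
  m e := G.1.m e.1
  p y := if ∃ k, r.K.p k = none ∧ μ.interface.V k = y.1 then none else G.1.p y.1

open Classical in
/-- The node part of the comatch `R → H`, where the node set of the result graph `H` is the
disjoint union of that of the intermediate graph and that of `R \ K`. -/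
noncomputable def comatchV (x : r.R.1.V) :
    μ.intermediate.V ⊕ {x : r.R.1.V // x ∉ Set.range r.inR.V} :=
  if h : ∃ k, r.inR.V k = x then
    Sum.inl ⟨μ.interface.V h.choose, μ.interface_not_deleted h.choose⟩
  else Sum.inr ⟨x, h⟩

open Classical in
/-- The result graph: `R \ K` is added disjointly to the intermediate graph, keeping labels and
rootedness, and the image of each unlabelled node of `K` gets its label in `R`, the image of each
node of `K` with undefined rootedness gets its rootedness in `R`. -/
noncomputable def resultGraph : PLRG.{u, v, w} 𝓛 where
  V := μ.intermediate.V ⊕ {x : r.R.1.V // x ∉ Set.range r.inR.V}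
  E := μ.intermediate.E ⊕ {e : r.R.1.E // e ∉ Set.range r.inR.E}
  finite_V := haveI := μ.intermediate.finite_V; haveI := r.R.1.finite_V; inferInstance
  finite_E := haveI := μ.intermediate.finite_E; haveI := r.R.1.finite_E; inferInstance
  s := Sum.elim (fun e => Sum.inl (μ.intermediate.s e)) (fun e => μ.comatchV (r.R.1.s e.1))
  t := Sum.elim (fun e => Sum.inl (μ.intermediate.t e)) (fun e => μ.comatchV (r.R.1.t e.1))
  l := Sum.elim
    (fun y => if h : ∃ k, r.K.l k = none ∧ μ.interface.V k = y.1 then r.R.1.l (r.inR.V h.choose)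
      else μ.intermediate.l y)
    (fun x => r.R.1.l x.1)
  m := Sum.elim μ.intermediate.m (fun e => r.R.1.m e.1)
  p := Sum.elim
    (fun y => if h : ∃ k, r.K.p k = none ∧ μ.interface.V k = y.1 then r.R.1.p (r.inR.V h.choose)
      else μ.intermediate.p y)
    (fun x => r.R.1.p x.1)

open Classical in
theorem resultGraph_isTLRG : μ.resultGraph.IsTLRG := by
  constructor
  · rintro (y | x)
    · change Option.isSome (dite _ _ _) = true
      split_ifs with h
      · exact r.R.2.1 _
      · change Option.isSome (ite _ _ _) = true
        rw [if_neg h]; exact G.2.1 _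
    · exact r.R.2.1 _
  · rintro (y | x)
    · change Option.isSome (dite _ _ _) = true
      split_ifs with h
      · exact r.R.2.2 _
      · change Option.isSome (ite _ _ _) = true
        rw [if_neg h]; exact G.2.2 _
    · exact r.R.2.2 _

/-- The result graph, as a totally labelled, totally rooted graph. -/
noncomputable def result : TLRG.{u, v, w} 𝓛 := ⟨μ.resultGraph, μ.resultGraph_isTLRG⟩

end Match

/-- A direct derivation `G ⇒_{r,g} M`: a match, and an identification of `M` with the result graph
up to isomorphism. -/
structure DirectDerivation (r : Rule.{u, v, w} 𝓛) (G M : TLRG.{u, v, w} 𝓛) where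
  μ : Match r G
  iso : Iso μ.result.1 M.1

/-- The track morphism of a direct derivation (on nodes): a partial function, which is undefined
exactly on the deleted nodes. -/
def DirectDerivation.track {r : Rule.{u, v, w} 𝓛} {G M : TLRG.{u, v, w} 𝓛}
    (d : DirectDerivation r G M) : G.1.V →. M.1.V :=
  fun x => ⟨x ∉ d.μ.deletedV, fun h => d.iso.hom.V (Sum.inl ⟨x, h⟩)⟩

/-! ### Graph transformation systems, confluence -/

/-- A graph transformation system over `𝓛`: a finite set of rules. -/
structure GTSystem (𝓛 : LabelAlphabet.{u, v}) where
  rules : Set (Rule.{u, v, w} 𝓛)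
  finite_rules : rules.Finite

/-- Derivations `G ⇒* M`: isomorphisms, or finite sequences of direct derivations. -/
inductive Derivation (T : GTSystem.{u, v, w} 𝓛) : TLRG.{u, v, w} 𝓛 → TLRG.{u, v, w} 𝓛 →
    Type (max u v (w + 1)) where
  | iso {G M : TLRG.{u, v, w} 𝓛} (f : Iso G.1 M.1) : Derivation T G M
  | step {G H M : TLRG.{u, v, w} 𝓛} (r : Rule.{u, v, w} 𝓛) (hr : r ∈ T.rules)
      (d : DirectDerivation r G H) (ds : Derivation T H M) : Derivation T G M

/-- The track morphism of a derivation (on nodes): the composition of the tracks of its steps. -/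
def Derivation.track {T : GTSystem.{u, v, w} 𝓛} {G M : TLRG.{u, v, w} 𝓛} :
    Derivation T G M → (G.1.V →. M.1.V)
  | .iso f => fun x => Part.some (f.hom.V x)
  | .step _ _ d ds => ds.track.comp d.track

namespace GTSystem

variable (T : GTSystem.{u, v, w} 𝓛)

/-- `G` directly derives `H` by some rule of the system. -/
def DirectlyDerives (G H : TLRG.{u, v, w} 𝓛) : Prop :=
  ∃ r ∈ T.rules, Nonempty (DirectDerivation r G H)

def Joinable (H₁ H₂ : TLRG.{u, v, w} 𝓛) : Prop :=
  ∃ M : TLRG.{u, v, w} 𝓛, Nonempty (Derivation T H₁ M) ∧ Nonempty (Derivation T H₂ M)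

/-- Local confluence on `D` (local confluence up to garbage). -/
def LocallyConfluentOn (D : Set (AbstractTLRG.{u, v, w} 𝓛)) : Prop :=
  ∀ G H₁ H₂ : TLRG.{u, v, w} 𝓛, G.cls ∈ D → T.DirectlyDerives G H₁ → T.DirectlyDerives G H₂ →
    T.Joinable H₁ H₂

end GTSystem

/-! ### Critical pairs -/

/-- A pair of direct derivations `H₁ ⇐_{r₁,g₁} G ⇒_{r₂,g₂} H₂` by rules of the system. -/
structure DerivationPair (T : GTSystem.{u, v, w} 𝓛) where
  G : TLRG.{u, v, w} 𝓛
  H₁ : TLRG.{u, v, w} 𝓛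
  H₂ : TLRG.{u, v, w} 𝓛
  r₁ : Rule.{u, v, w} 𝓛
  r₂ : Rule.{u, v, w} 𝓛
  mem₁ : r₁ ∈ T.rules
  mem₂ : r₂ ∈ T.rules
  d₁ : DirectDerivation r₁ G H₁
  d₂ : DirectDerivation r₂ G H₂

namespace DerivationPair

variable {T : GTSystem.{u, v, w} 𝓛} (Φ : DerivationPair T)

/-- `g₁(L₁) ∩ g₂(L₂) ⊆ g₁(K₁) ∩ g₂(K₂)`. -/
def ParallelIndependent : Prop :=
  Φ.d₁.μ.g.image ∩ Φ.d₂.μ.g.image ⊆ Φ.d₁.μ.interface.image ∩ Φ.d₂.μ.interface.image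

/-- The last condition says that if `r₁ = r₂`, then `g₁ ≠ g₂`. -/
structure IsCritical : Prop where
  cover : Φ.G.1.items = Φ.d₁.μ.g.image ∪ Φ.d₂.μ.g.image
  not_independent : ¬ Φ.ParallelIndependent
  distinct : (⟨Φ.r₁, Φ.d₁.μ⟩ : Σ r, Match r Φ.G) ≠ ⟨Φ.r₂, Φ.d₂.μ⟩

/-- Non-garbage with respect to `D`. -/
def NonGarbage (D : Set (AbstractTLRG.{u, v, w} 𝓛)) : Prop := Φ.G.cls ∈ subgraphClosure D

/-- The persistent nodes: those deleted by neither of the two steps. -/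
def persist : Set Φ.G.1.V := {x | (Φ.d₁.track x).Dom ∧ (Φ.d₂.track x).Dom}

/-- Joinable, with all persistent nodes preserved and identified. -/
def StronglyJoinable : Prop :=
  ∃ (M : TLRG.{u, v, w} 𝓛) (δ₁ : Derivation T Φ.H₁ M) (δ₂ : Derivation T Φ.H₂ M),
    ∀ x ∈ Φ.persist,
      (δ₁.track.comp Φ.d₁.track) x = (δ₂.track.comp Φ.d₂.track) x ∧
      ((δ₁.track.comp Φ.d₁.track) x).Dom

end DerivationPair

end RGT

/-!
A rule application removes part of a graph and glues the right-hand side `R` along `K` to what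
remains. Gluings are pushouts on nodes and on edges, so they are unique up to isomorphism and can be
interchanged; hence two parallelly independent steps commute. For two other, different steps from
`G`, restrict both matches to `F = g₁(L₁) ∪ g₂(L₂)`. This is a critical pair, and non-garbage since
`F` is a subgraph of `G`. By the dangling condition, an edge of `G` outside `F` touches `F` in
persistent nodes only, so `G` is `F` with a context attached at its persistent nodes; since `F` is
totally labelled, the context need not label these nodes. Strong joinability says that the joining
derivations keep the nodes at which the context is attached, and identify them. So both derivations
extend to `G`, and both end in their common result with the context attached at the same nodes.
-/

namespace RGT

open CategoryTheory CategoryTheory.Limits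

variable {𝓛 : LabelAlphabet.{u, v}}

/-! ### Amalgamated unions of sets -/

section Sets

variable {A B C D K M P R X X' Z Z' : Type w} {α : Type*}

/-- The set `Z` is the union of `X` and `C` amalgamated over their common subset `B`. -/
structure IsAmalgam (b : B → X) (c : B → C) (p : X → Z) (q : C → Z) : Prop where
  left_injective : Function.Injective b
  right_injective : Function.Injective c
  isPushout : IsPushout (↾b) (↾c) (↾p) (↾q)

namespace IsAmalgam

variable {b : B → X} {c : B → C} {p : X → Z} {q : C → Z}

theorem of_jointly_surjective (hp : Function.Injective p) (hq : Function.Injective q)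
    (hb : Function.Injective b) (comm : ∀ β, p (b β) = q (c β))
    (inter : ∀ x y, p x = q y → ∃ β, b β = x ∧ c β = y)
    (cover : ∀ z, (∃ x, p x = z) ∨ ∃ y, q y = z) : IsAmalgam b c p q where
  left_injective := hb
  right_injective β β' h := hb (hp (by rw [comm, comm, h]))
  isPushout := by
    have : Mono (↾p) := (ofHom_mono_iff_injective p).2 hp
    refine Types.isPushout_of_isPullback_of_mono'
      ((Types.isPullback_iff _ _ _ _).2 ⟨?_, fun _ _ h => hb h.1, inter⟩)
      (Set.eq_univ_of_forall cover) fun _ _ _ _ h => hq h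
    ext β
    exact comm β

variable (h : IsAmalgam b c p q)
include h

theorem comm (β : B) : p (b β) = q (c β) :=
  ConcreteCategory.congr_hom h.isPushout.w β

theorem flip : IsAmalgam c b q p := ⟨h.right_injective, h.left_injective, h.isPushout.flip⟩

theorem inr_injective : Function.Injective q :=
  Types.pushoutCocone_inr_injective_of_isColimit h.isPushout.isColimit h.left_injective

theorem inl_injective : Function.Injective p := h.flip.inr_injective

theorem cover (z : Z) : (∃ x, p x = z) ∨ ∃ y, q y = z := Types.eq_or_eq_of_isPushout h.isPushout z

theorem inter {x : X} {y : C} (hxy : p x = q y) : ∃ β, b β = x ∧ c β = y :=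
  Types.exists_of_isPullback (Types.isPullback_of_isPushout h.isPushout h.left_injective) x y hxy

theorem exists_desc (f : X → M) (g : C → M) (hfg : ∀ β, f (b β) = g (c β)) :
    ∃ t : Z → M, (∀ x, t (p x) = f x) ∧ ∀ y, t (q y) = g y := by
  have w : ↾b ≫ ↾f = ↾c ≫ ↾g := by ext β; exact hfg β
  exact ⟨h.isPushout.desc (↾f) (↾g) w,
    ConcreteCategory.congr_hom (h.isPushout.inl_desc _ _ w),
    ConcreteCategory.congr_hom (h.isPushout.inr_desc _ _ w)⟩

theorem hom_ext {N : Type*} {t t' : Z → N} (hp : ∀ x, t (p x) = t' (p x))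
    (hq : ∀ y, t (q y) = t' (q y)) : t = t' := by
  funext z
  obtain ⟨x, rfl⟩ | ⟨y, rfl⟩ := h.cover z
  exacts [hp x, hq y]

end IsAmalgam

theorem IsAmalgam.interchange {b : B → D} {c : B → C} {p : D → P} {q : C → P}
    {k : K → D} {r : K → R} {a : D → A} {s : R → A} {m : P → M} {n : R → M} {t : A → M}
    (hP : IsAmalgam b c p q) (hA : IsAmalgam k r a s) (hM : IsAmalgam (p ∘ k) r m n)
    (hta : ∀ d, t (a d) = m (p d)) (hts : ∀ x, t (s x) = n x) :
    IsAmalgam (a ∘ b) c t (m ∘ q) where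
  left_injective := hA.inl_injective.comp hP.left_injective
  right_injective := hP.right_injective
  isPushout := by
    have hpa : ↾p ≫ ↾m = ↾a ≫ ↾t := by ext d; exact (hta d).symm
    have hn : ↾n = ↾s ≫ ↾t := by ext x; exact (hts x).symm
    have outer : IsPushout (↾k ≫ ↾p) (↾r) (↾m) (↾s ≫ ↾t) := hn ▸ hM.isPushout
    exact (hP.isPushout.flip.paste_vert (outer.of_left hpa hA.isPushout)).flip

theorem IsAmalgam.restrict {b : B → X} {c : B → C} {p : X → Z} {q : C → Z}
    {e : X' → X} {e' : Z' → Z} {b' : B → X'} {p' : X' → Z'} {q' : C → Z'}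
    (h : IsAmalgam b c p q) (he : Function.Injective e) (he' : Function.Injective e')
    (hrange : ∀ x, p x ∈ Set.range e' → x ∈ Set.range e) (hb : ∀ β, e (b' β) = b β)
    (hp : ∀ x, e' (p' x) = p (e x)) (hq : ∀ y, e' (q' y) = q y) : IsAmalgam b' c p' q' := by
  refine .of_jointly_surjective (fun x y hxy => ?_) (fun x y hxy => ?_) (fun x y hxy => ?_)
    (fun β => ?_) (fun x y hxy => ?_) fun z => ?_
  · exact he (h.inl_injective (by rw [← hp, ← hp, hxy]))
  · exact h.inr_injective (by rw [← hq, ← hq, hxy])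
  · exact h.left_injective (by rw [← hb, ← hb, hxy])
  · exact he' (by rw [hp, hb, hq, h.comm])
  · obtain ⟨β, hβ, rfl⟩ := h.inter (x := e x) (y := y) (by rw [← hp, ← hq, hxy])
    exact ⟨β, he (by rw [hb, hβ]), rfl⟩
  · obtain ⟨x, hx⟩ | ⟨y, hy⟩ := h.cover (e' z)
    · obtain ⟨x', rfl⟩ := hrange x ⟨z, hx.symm⟩
      exact .inl ⟨x', he' (by rw [hp, hx])⟩
    · exact .inr ⟨y, he' (by rw [hq, hy])⟩

theorem IsAmalgam.transport {b : B → X} {c : B → C} {p : X → Z} {q : C → Z}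
    (h : IsAmalgam b c p q) (φ : X ≃ X') (ψ : Z ≃ Z') :
    IsAmalgam (φ ∘ b) c (ψ ∘ p ∘ φ.symm) (ψ ∘ q) := by
  refine .of_jointly_surjective (ψ.injective.comp (h.inl_injective.comp φ.symm.injective))
    (ψ.injective.comp h.inr_injective) (φ.injective.comp h.left_injective) (fun β => ?_)
    (fun x y hxy => ?_) fun z => ?_
  · simp only [Function.comp_apply, Equiv.symm_apply_apply, h.comm]
  · obtain ⟨β, hβ, rfl⟩ := h.inter (ψ.injective hxy)
    exact ⟨β, φ.symm.injective (by simp only [hβ, Function.comp_apply, φ.symm_apply_apply]), rfl⟩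
  · obtain ⟨x, hx⟩ | ⟨y, hy⟩ := h.cover (ψ.symm z)
    · exact .inl ⟨φ x, by simp [hx]⟩
    · exact .inr ⟨y, by simp [hy]⟩

/-- Every label of `Z` comes from a label of `X` or of `C`. Labellings are partial functions,
and both node labels and rootedness are instances. -/
def LabelsCover (p : X → Z) (q : C → Z) (ξ : X → Option α) (γ : C → Option α)
    (ζ : Z → Option α) : Prop :=
  ∀ z a, ζ z = some a → (∃ x, p x = z ∧ ξ x = some a) ∨ ∃ y, q y = z ∧ γ y = some a

namespace LabelsCover

theorem transport {p : X → Z} {q : C → Z} {ξ : X → Option α} {γ : C → Option α} {ζ : Z → Option α}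
    (h : LabelsCover p q ξ γ ζ) (φ : X ≃ X') (ψ : Z ≃ Z') {ξ' : X' → Option α}
    {ζ' : Z' → Option α} (hξ : ∀ x a, ξ x = some a → ξ' (φ x) = some a)
    (hζ : ∀ z a, ζ' z = some a → ζ (ψ.symm z) = some a) :
    LabelsCover (ψ ∘ p ∘ φ.symm) (ψ ∘ q) ξ' γ ζ' := fun z a hz => by
  obtain ⟨x, hx, hxa⟩ | ⟨y, hy, hya⟩ := h _ a (hζ z a hz)
  · exact .inl ⟨φ x, by simp [hx], hξ x a hxa⟩
  · exact .inr ⟨y, by simp [hy], hya⟩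

theorem interchange {p : D → P} {q : C → P} {a : D → A} {s : R → A} {m : P → M} {n : R → M}
    {t : A → M} {δ : D → Option α} {γ : C → Option α} {π : P → Option α} {ρ : R → Option α}
    {σ : A → Option α} {μ : M → Option α} (hP : LabelsCover p q δ γ π) (hM : LabelsCover m n π ρ μ)
    (hta : ∀ d, t (a d) = m (p d)) (hts : ∀ x, t (s x) = n x)
    (hδ : ∀ d i, δ d = some i → σ (a d) = some i) (hρ : ∀ x i, ρ x = some i → σ (s x) = some i) :
    LabelsCover t (m ∘ q) σ γ μ := fun z i hz => by
  obtain ⟨y, rfl, hy⟩ | ⟨x, rfl, hx⟩ := hM z i hz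
  · obtain ⟨d, rfl, hd⟩ | ⟨y', rfl, hy'⟩ := hP y i hy
    · exact .inl ⟨a d, hta d, hδ d i hd⟩
    · exact .inr ⟨y', rfl, hy'⟩
  · exact .inl ⟨s x, hts x, hρ x i hx⟩

theorem restrict {p : X → Z} {q : C → Z} {e : X' → X} {e' : Z' → Z} {p' : X' → Z'} {q' : C → Z'}
    {ξ : X → Option α} {γ : C → Option α} {ζ : Z → Option α} {ξ' : X' → Option α}
    {ζ' : Z' → Option α} (h : LabelsCover p q ξ γ ζ) (he' : Function.Injective e')
    (hrange : ∀ x, p x ∈ Set.range e' → x ∈ Set.range e) (hp : ∀ x, e' (p' x) = p (e x))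
    (hq : ∀ y, e' (q' y) = q y) (hζ : ∀ z a, ζ' z = some a → ζ (e' z) = some a)
    (hξ : ∀ x a, ζ' (p' x) = some a → ξ (e x) = some a → ξ' x = some a) :
    LabelsCover p' q' ξ' γ ζ' := fun z a hz => by
  obtain ⟨x, hx, hxa⟩ | ⟨y, hy, hya⟩ := h _ a (hζ z a hz)
  · obtain ⟨x', rfl⟩ := hrange x ⟨z, hx.symm⟩
    obtain rfl : p' x' = z := he' (by rw [hp, hx])
    exact .inl ⟨x', rfl, hξ x' a hz hxa⟩
  · exact .inr ⟨y, he' (by rw [hq, hy]), hya⟩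

end LabelsCover

end Sets

/-! ### Graph morphisms -/

section Graphs

variable {A B C D G G' K L M N P R X X' : PLRG.{u, v, w} 𝓛}

namespace Hom

theorem congr_V {f f' : Hom G M} (h : f = f') (x : G.V) : f.V x = f'.V x := h ▸ rfl

theorem congr_E {f f' : Hom G M} (h : f = f') (e : G.E) : f.E e = f'.E e := h ▸ rfl

theorem Injective.comp {g : Hom G M} {f : Hom A G} (hg : g.Injective) (hf : f.Injective) :
    (g.comp f).Injective := ⟨hg.1.comp hf.1, hg.2.comp hf.2⟩

theorem Injective.of_comp {g : Hom G M} {f : Hom A G} (h : (g.comp f).Injective) :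
    f.Injective := ⟨.of_comp h.1, .of_comp h.2⟩

theorem Injective.cancel_left {g : Hom G M} (hg : g.Injective) {f f' : Hom A G}
    (h : g.comp f = g.comp f') : f = f' :=
  Hom.ext (funext fun x => hg.1 (congr_V h x)) (funext fun e => hg.2 (congr_E h e))

theorem exists_lift {i : Hom X G} (hi : i.Injective) (f : Hom A G)
    (nodes : ∀ y, f.V y ∈ Set.range i.V) (edges : ∀ e, f.E e ∈ Set.range i.E)
    (labels : ∀ y x a, i.V x = f.V y → A.l y = some a → X.l x = some a)
    (roots : ∀ y x a, i.V x = f.V y → A.p y = some a → X.p x = some a) :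
    ∃ f' : Hom A X, i.comp f' = f := by
  choose fV hV using nodes
  choose fE hE using edges
  exact ⟨{
    V := fV
    E := fE
    source := fun e => hi.1 (by rw [hV, i.source, hE, f.source])
    target := fun e => hi.1 (by rw [hV, i.target, hE, f.target])
    edgeLabel := fun e => by rw [i.edgeLabel, hE, f.edgeLabel]
    nodeLabel := fun y a => labels y _ a (hV y)
    rootedness := fun y a => roots y _ a (hV y) }, Hom.ext (funext hV) (funext hE)⟩

end Hom

namespace Iso

/-- The bijection on nodes underlying an isomorphism of graphs. -/
def equivV (φ : Iso G M) : G.V ≃ M.V where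
  toFun := φ.hom.V
  invFun := φ.inv.V
  left_inv := Hom.congr_V φ.hom_inv
  right_inv := Hom.congr_V φ.inv_hom

/-- The bijection on edges underlying an isomorphism of graphs. -/
def equivE (φ : Iso G M) : G.E ≃ M.E where
  toFun := φ.hom.E
  invFun := φ.inv.E
  left_inv := Hom.congr_E φ.hom_inv
  right_inv := Hom.congr_E φ.inv_hom

end Iso

/-! ### Gluing graphs along a common subgraph -/

/-- The graph `G` is the union of `X` and `C` amalgamated over their common subgraph `B`: the
nodes and the edges form pushout squares, and `G` has no labels besides those of `X` and `C`. -/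
structure IsGluing (b : Hom B X) (c : Hom B C) (p : Hom X G) (q : Hom C G) : Prop where
  nodes : IsAmalgam b.V c.V p.V q.V
  edges : IsAmalgam b.E c.E p.E q.E
  labels : LabelsCover p.V q.V X.l C.l G.l
  roots : LabelsCover p.V q.V X.p C.p G.p

namespace IsGluing

section

variable {b : Hom B X} {c : Hom B C} {p : Hom X G} {q : Hom C G} (h : IsGluing b c p q)
include h

theorem comm : p.comp b = q.comp c := Hom.ext (funext h.nodes.comm) (funext h.edges.comm)

theorem inl_injective : p.Injective := ⟨h.nodes.inl_injective, h.edges.inl_injective⟩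

theorem exists_desc (f : Hom X N) (g : Hom C N) (hfg : f.comp b = g.comp c) :
    ∃ t : Hom G N, t.comp p = f ∧ t.comp q = g := by
  obtain ⟨tV, hVp, hVq⟩ := h.nodes.exists_desc f.V g.V (Hom.congr_V hfg)
  obtain ⟨tE, hEp, hEq⟩ := h.edges.exists_desc f.E g.E (Hom.congr_E hfg)
  refine ⟨⟨tV, tE, congrFun (h.edges.hom_ext (fun e => ?_) fun e => ?_),
    congrFun (h.edges.hom_ext (fun e => ?_) fun e => ?_),
    congrFun (h.edges.hom_ext (fun e => ?_) fun e => ?_), fun z a hz => ?_, fun z a hz => ?_⟩,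
    Hom.ext (funext hVp) (funext hEp), Hom.ext (funext hVq) (funext hEq)⟩
  · rw [← p.source, hVp, hEp, f.source]
  · rw [← q.source, hVq, hEq, g.source]
  · rw [← p.target, hVp, hEp, f.target]
  · rw [← q.target, hVq, hEq, g.target]
  · rw [← p.edgeLabel, hEp, f.edgeLabel]
  · rw [← q.edgeLabel, hEq, g.edgeLabel]
  · obtain ⟨x, rfl, hx⟩ | ⟨y, rfl, hy⟩ := h.labels z a hz
    · exact hVp x ▸ f.nodeLabel x a hx
    · exact hVq y ▸ g.nodeLabel y a hy
  · obtain ⟨x, rfl, hx⟩ | ⟨y, rfl, hy⟩ := h.roots z a hz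
    · exact hVp x ▸ f.rootedness x a hx
    · exact hVq y ▸ g.rootedness y a hy

theorem hom_ext {t t' : Hom G N} (hp : t.comp p = t'.comp p) (hq : t.comp q = t'.comp q) :
    t = t' :=
  Hom.ext (h.nodes.hom_ext (Hom.congr_V hp) (Hom.congr_V hq))
    (h.edges.hom_ext (Hom.congr_E hp) (Hom.congr_E hq))

theorem exists_iso {p' : Hom X G'} {q' : Hom C G'} (h' : IsGluing b c p' q') :
    ∃ φ : Iso G G', φ.hom.comp p = p' ∧ φ.hom.comp q = q' := by
  obtain ⟨t, htp, htq⟩ := h.exists_desc p' q' h'.comm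
  obtain ⟨t', htp', htq'⟩ := h'.exists_desc p q h.comm
  refine ⟨⟨t, t', h.hom_ext ?_ ?_, h'.hom_ext ?_ ?_⟩, htp, htq⟩
  · exact (congrArg t'.comp htp).trans htp'
  · exact (congrArg t'.comp htq).trans htq'
  · exact (congrArg t.comp htp').trans htp
  · exact (congrArg t.comp htq').trans htq

theorem transport (φ : Iso X X') (ψ : Iso G G') :
    IsGluing (φ.hom.comp b) c (ψ.hom.comp (p.comp φ.inv)) (ψ.hom.comp q) where
  nodes := h.nodes.transport φ.equivV ψ.equivV
  edges := h.edges.transport φ.equivE ψ.equivE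
  labels := h.labels.transport φ.equivV ψ.equivV φ.hom.nodeLabel ψ.inv.nodeLabel
  roots := h.roots.transport φ.equivV ψ.equivV φ.hom.rootedness ψ.inv.rootedness

end

theorem interchange {b : Hom B D} {c : Hom B C} {p : Hom D P} {q : Hom C P}
    {k : Hom K D} {r : Hom K R} {a : Hom D A} {s : Hom R A} {m : Hom P M} {n : Hom R M}
    (hP : IsGluing b c p q) (hA : IsGluing k r a s) (hM : IsGluing (p.comp k) r m n) :
    ∃ t : Hom A M, IsGluing (a.comp b) c t (m.comp q) := by
  obtain ⟨t, hta, hts⟩ := hA.exists_desc (m.comp p) n hM.comm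
  have htaV := Hom.congr_V hta
  have htsV := Hom.congr_V hts
  exact ⟨t,
    hP.nodes.interchange hA.nodes hM.nodes htaV htsV,
    hP.edges.interchange hA.edges hM.edges (Hom.congr_E hta) (Hom.congr_E hts),
    hP.labels.interchange hM.labels htaV htsV a.nodeLabel s.nodeLabel,
    hP.roots.interchange hM.roots htaV htsV a.rootedness s.rootedness⟩

end IsGluing

/-! ### Removing part of a graph -/

/-- The image of `f : A → G` is disjoint from what a rule `L ← K → R` removes from `G` at
`g : L → G`: the nodes and edges of `g(L ∖ K)`, and the labels (rootedness) of the nodes coming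
from unlabelled (unrooted) nodes of `K`. -/
structure Preserves (u : Hom K L) (g : Hom L G) (f : Hom A G) : Prop where
  node : ∀ x y, g.V x = f.V y → x ∈ Set.range u.V
  edge : ∀ x y, g.E x = f.E y → x ∈ Set.range u.E
  label : ∀ k y, g.V (u.V k) = f.V y → K.l k = none → A.l y = none
  root : ∀ k y, g.V (u.V k) = f.V y → K.p k = none → A.p y = none

namespace Preserves

variable {u : Hom K L} {g : Hom L G} {f : Hom A G}

theorem comp (h : Preserves u g f) (i : Hom B A) : Preserves u g (f.comp i) where
  node x y := h.node x (i.V y)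
  edge x y := h.edge x (i.E y)
  label k y hk hl := Option.eq_none_iff_forall_ne_some.2 fun a ha =>
    Option.some_ne_none a ((i.nodeLabel y a ha).symm.trans (h.label k (i.V y) hk hl))
  root k y hk hl := Option.eq_none_iff_forall_ne_some.2 fun a ha =>
    Option.some_ne_none a ((i.rootedness y a ha).symm.trans (h.root k (i.V y) hk hl))

theorem comp_left_iff {m : Hom G M} (hm : m.Injective) :
    Preserves u (m.comp g) (m.comp f) ↔ Preserves u g f where
  mp h :=
    { node := fun x y e => h.node x y (congrArg m.V e)
      edge := fun x y e => h.edge x y (congrArg m.E e)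
      label := fun k y e => h.label k y (congrArg m.V e)
      root := fun k y e => h.root k y (congrArg m.V e) }
  mpr h :=
    { node := fun x y e => h.node x y (hm.1 e)
      edge := fun x y e => h.edge x y (hm.2 e)
      label := fun k y e => h.label k y (hm.1 e)
      root := fun k y e => h.root k y (hm.1 e) }

theorem source_ne_and_target_ne (h : Preserves u g f) (e : A.E) {x : L.V}
    (hx : x ∉ Set.range u.V) : G.s (f.E e) ≠ g.V x ∧ G.t (f.E e) ≠ g.V x :=
  ⟨fun hs => hx (h.node x (A.s e) (by rw [f.source, hs])),
    fun ht => hx (h.node x (A.t e) (by rw [f.target, ht]))⟩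

end Preserves

/-- `X` is what remains of `G` when a rule `L ← K → R` removes its share at `g : L → G`, that is,
the largest part of `G` preserved in the sense of `Preserves`. -/
structure IsRemainder (u : Hom K L) (g : Hom L G) (e : Hom X G) : Prop where
  injective : e.Injective
  preserves : Preserves u g e
  node : ∀ y, (∀ x, g.V x = y → x ∈ Set.range u.V) → y ∈ Set.range e.V
  edge : ∀ y, (∀ x, g.E x = y → x ∈ Set.range u.E) → y ∈ Set.range e.E
  label : ∀ x a, G.l (e.V x) = some a → (∀ k, g.V (u.V k) = e.V x → K.l k ≠ none) →
    X.l x = some a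
  root : ∀ x a, G.p (e.V x) = some a → (∀ k, g.V (u.V k) = e.V x → K.p k ≠ none) →
    X.p x = some a

namespace IsRemainder

variable {u : Hom K L} {g : Hom L G} {e : Hom X G}

theorem exists_lift (h : IsRemainder u g e) {f : Hom A G} (hf : Preserves u g f) :
    ∃ f' : Hom A X, e.comp f' = f := by
  refine Hom.exists_lift h.injective f (fun y => h.node _ fun x hx => hf.node x y hx)
    (fun y => h.edge _ fun x hx => hf.edge x y hx) (fun y x a hx hy => ?_) fun y x a hx hy => ?_
  · refine h.label x a (hx ▸ f.nodeLabel y a hy) fun k hk hl => Option.some_ne_none a ?_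
    exact hy.symm.trans (hf.label k y (hk.trans hx) hl)
  · refine h.root x a (hx ▸ f.rootedness y a hy) fun k hk hl => Option.some_ne_none a ?_
    exact hy.symm.trans (hf.root k y (hk.trans hx) hl)

end IsRemainder

theorem IsGluing.restrict {b : Hom B X} {c : Hom B C} {p : Hom X G} {q : Hom C G} {u : Hom K L}
    {g : Hom L X} {e : Hom X' X} {e' : Hom G' G} (h : IsGluing b c p q) (he : IsRemainder u g e)
    (he' : IsRemainder u (p.comp g) e') (hq : Preserves u (p.comp g) q) :
    ∃ (b' : Hom B X') (p' : Hom X' G') (q' : Hom C G'),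
      e.comp b' = b ∧ e'.comp p' = p.comp e ∧ IsGluing b' c p' q' := by
  have hp := h.inl_injective
  obtain ⟨b', hb'⟩ :=
    he.exists_lift ((Preserves.comp_left_iff hp).1 (h.comm ▸ hq.comp c : Preserves _ _ (p.comp b)))
  obtain ⟨p', hp'⟩ := he'.exists_lift ((Preserves.comp_left_iff hp).2 he.preserves)
  obtain ⟨q', hq'⟩ := he'.exists_lift hq
  have hrangeV : ∀ x, p.V x ∈ Set.range e'.V → x ∈ Set.range e.V := fun x ⟨z, hz⟩ =>
    he.node x fun y hy => he'.preserves.node y z ((congrArg p.V hy).trans hz.symm)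
  have hrangeE : ∀ x, p.E x ∈ Set.range e'.E → x ∈ Set.range e.E := fun x ⟨z, hz⟩ =>
    he.edge x fun y hy => he'.preserves.edge y z ((congrArg p.E hy).trans hz.symm)
  have hpV := Hom.congr_V hp'
  have hqV := Hom.congr_V hq'
  refine ⟨b', p', q', hb', hp',
    h.nodes.restrict he.injective.1 he'.injective.1 hrangeV (Hom.congr_V hb') hpV hqV,
    h.edges.restrict he.injective.2 he'.injective.2 hrangeE (Hom.congr_E hb') (Hom.congr_E hp')
      (Hom.congr_E hq'),
    h.labels.restrict he'.injective.1 hrangeV hpV hqV e'.nodeLabel fun x a hz hx => ?_,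
    h.roots.restrict he'.injective.1 hrangeV hpV hqV e'.rootedness fun x a hz hx => ?_⟩
  · refine he.label x a hx fun k hk hl => Option.some_ne_none a (hz.symm.trans ?_)
    exact he'.preserves.label k _ ((congrArg p.V hk).trans (hpV x).symm) hl
  · refine he.root x a hx fun k hk hl => Option.some_ne_none a (hz.symm.trans ?_)
    exact he'.preserves.root k _ ((congrArg p.V hk).trans (hpV x).symm) hl

/-- `P` is the intersection of `A` and `B` as parts of `G`, labels and rootedness included. -/
structure IsIntersection (f : Hom A G) (g : Hom B G) (i : Hom P A) (j : Hom P B) : Prop where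
  comm : f.comp i = g.comp j
  left_injective : i.Injective
  right_injective : j.Injective
  node : ∀ x y, f.V x = g.V y → ∃ z, i.V z = x ∧ j.V z = y
  edge : ∀ x y, f.E x = g.E y → ∃ z, i.E z = x ∧ j.E z = y
  label : ∀ z a, A.l (i.V z) = some a → B.l (j.V z) = some a → P.l z = some a
  root : ∀ z a, A.p (i.V z) = some a → B.p (j.V z) = some a → P.p z = some a

namespace IsIntersection

theorem flip {f : Hom A G} {g : Hom B G} {i : Hom P A} {j : Hom P B}
    (h : IsIntersection f g i j) : IsIntersection g f j i where
  comm := h.comm.symm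
  left_injective := h.right_injective
  right_injective := h.left_injective
  node x y hxy := (h.node y x hxy.symm).imp fun _ => And.symm
  edge x y hxy := (h.edge y x hxy.symm).imp fun _ => And.symm
  label z a hi hj := h.label z a hj hi
  root z a hi hj := h.root z a hj hi

theorem isRemainder {e : Hom A G} {e' : Hom B G} {i : Hom P A} {j : Hom P B} {u : Hom K L}
    {g : Hom L A} (h : IsIntersection e e' i j) (he : e.Injective)
    (he' : IsRemainder u (e.comp g) e') : IsRemainder u g i where
  injective := h.left_injective
  preserves := (Preserves.comp_left_iff he).1 (h.comm ▸ he'.preserves.comp j)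
  node y hy := by
    obtain ⟨y', hy'⟩ := he'.node (e.V y) fun x hx => hy x (he.1 hx)
    exact (h.node y y' hy'.symm).imp fun _ => And.left
  edge y hy := by
    obtain ⟨y', hy'⟩ := he'.edge (e.E y) fun x hx => hy x (he.2 hx)
    exact (h.edge y y' hy'.symm).imp fun _ => And.left
  label z a hz hk := by
    have hz' := Hom.congr_V h.comm z
    refine h.label z a hz (he'.label _ a (hz' ▸ e.nodeLabel _ a hz) fun k hk' => hk k (he.1 ?_))
    exact hk'.trans hz'.symm
  root z a hz hk := by
    have hz' := Hom.congr_V h.comm z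
    refine h.root z a hz (he'.root _ a (hz' ▸ e.rootedness _ a hz) fun k hk' => hk k (he.1 ?_))
    exact hk'.trans hz'.symm

end IsIntersection

open Classical in
/-- The common value of two partially defined values, undefined if they differ. It labels the
intersection of two partially labelled graphs. -/
noncomputable def commonValue {α : Type*} (o o' : Option α) : Option α := if o = o' then o else none

theorem commonValue_eq_some_iff {α : Type*} {o o' : Option α} {x : α} :
    commonValue o o' = some x ↔ o = some x ∧ o' = some x := by
  unfold commonValue
  grind

namespace Hom

/-- The intersection of two subgraphs `f : A → G` and `g : B → G`; a node keeps its label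
(rootedness) if it is defined in both of them. -/
noncomputable def inter (f : Hom A G) (g : Hom B G) : PLRG.{u, v, w} 𝓛 where
  V := {z : A.V × B.V // f.V z.1 = g.V z.2}
  E := {z : A.E × B.E // f.E z.1 = g.E z.2}
  finite_V := haveI := A.finite_V; haveI := B.finite_V; inferInstance
  finite_E := haveI := A.finite_E; haveI := B.finite_E; inferInstance
  s e := ⟨(A.s e.1.1, B.s e.1.2), by rw [f.source, e.2, g.source]⟩
  t e := ⟨(A.t e.1.1, B.t e.1.2), by rw [f.target, e.2, g.target]⟩
  l z := commonValue (A.l z.1.1) (B.l z.1.2)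
  m e := A.m e.1.1
  p z := commonValue (A.p z.1.1) (B.p z.1.2)

/-- The inclusion of `f.inter g` into the domain of `f`. -/
noncomputable def interFst (f : Hom A G) (g : Hom B G) : Hom (f.inter g) A where
  V z := z.1.1
  E e := e.1.1
  source _ := rfl
  target _ := rfl
  edgeLabel _ := rfl
  nodeLabel _ _ h := (commonValue_eq_some_iff.1 h).1
  rootedness _ _ h := (commonValue_eq_some_iff.1 h).1

/-- The inclusion of `f.inter g` into the domain of `g`. -/
noncomputable def interSnd (f : Hom A G) (g : Hom B G) : Hom (f.inter g) B where
  V z := z.1.2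
  E e := e.1.2
  source _ := rfl
  target _ := rfl
  edgeLabel e := (f.edgeLabel _).trans ((congrArg G.m e.2).trans (g.edgeLabel _).symm)
  nodeLabel _ _ h := (commonValue_eq_some_iff.1 h).2
  rootedness _ _ h := (commonValue_eq_some_iff.1 h).2

theorem isIntersection_inter {f : Hom A G} {g : Hom B G} (hf : f.Injective) (hg : g.Injective) :
    IsIntersection f g (f.interFst g) (f.interSnd g) where
  comm := Hom.ext (funext fun z => z.2) (funext fun e => e.2)
  left_injective :=
    ⟨fun z z' h => Subtype.ext (Prod.ext h (hg.1 (z.2.symm.trans ((congrArg f.V h).trans z'.2)))),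
      fun z z' h => Subtype.ext (Prod.ext h (hg.2 (z.2.symm.trans ((congrArg f.E h).trans z'.2))))⟩
  right_injective :=
    ⟨fun z z' h => Subtype.ext (Prod.ext (hf.1 (z.2.trans ((congrArg g.V h).trans z'.2.symm))) h),
      fun z z' h => Subtype.ext (Prod.ext (hf.2 (z.2.trans ((congrArg g.E h).trans z'.2.symm))) h)⟩
  node x y h := ⟨⟨(x, y), h⟩, rfl, rfl⟩
  edge x y h := ⟨⟨(x, y), h⟩, rfl, rfl⟩
  label _ _ hi hj := commonValue_eq_some_iff.2 ⟨hi, hj⟩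
  root _ _ hi hj := commonValue_eq_some_iff.2 ⟨hi, hj⟩

end Hom

/-! ### Direct derivations as gluings -/

section

variable {K R Y Z : Type w} {α : Type*}

open Classical in
/-- The inclusion of `R` into the amalgamated union `Y ⊕ (R ∖ K)` of `Y` and `R` over `K`. -/
noncomputable def sumInr (k : K → Y) (j : K → R) (x : R) : Y ⊕ {x : R // x ∉ Set.range j} :=
  if h : ∃ i, j i = x then .inl (k h.choose) else .inr ⟨x, h⟩

theorem sumInr_apply {k : K → Y} {j : K → R} (hj : Function.Injective j) (i : K) :
    sumInr k j (j i) = .inl (k i) := by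
  have h : ∃ i', j i' = j i := ⟨i, rfl⟩
  exact (dif_pos h).trans (congrArg (fun i => Sum.inl (k i)) (hj h.choose_spec))

theorem sumInr_of_notMem {k : K → Y} {j : K → R} {x : R} (hx : x ∉ Set.range j) :
    sumInr k j x = .inr ⟨x, hx⟩ := dif_neg hx

theorem isAmalgam_sum {k : K → Y} {j : K → R} (hk : Function.Injective k)
    (hj : Function.Injective j) : IsAmalgam k j Sum.inl (sumInr k j) := by
  refine .of_jointly_surjective Sum.inl_injective (fun x y hxy => ?_) hk
    (fun i => (sumInr_apply hj i).symm) (fun y x hxy => ?_) (Sum.rec (fun y => .inl ⟨y, rfl⟩)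
      fun x => .inr ⟨x, sumInr_of_notMem x.2⟩)
  · rcases em (x ∈ Set.range j) with ⟨i, rfl⟩ | hx <;>
      rcases em (y ∈ Set.range j) with ⟨i', rfl⟩ | hy
    · rw [sumInr_apply hj, sumInr_apply hj] at hxy
      rw [hk (Sum.inl_injective hxy)]
    · rw [sumInr_apply hj, sumInr_of_notMem hy] at hxy
      exact absurd hxy Sum.inl_ne_inr
    · rw [sumInr_of_notMem hx, sumInr_apply hj] at hxy
      exact absurd hxy Sum.inr_ne_inl
    · rw [sumInr_of_notMem hx, sumInr_of_notMem hy] at hxy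
      exact congrArg Subtype.val (Sum.inr_injective hxy)
  · by_cases hx : x ∈ Set.range j
    · obtain ⟨i, rfl⟩ := hx
      rw [sumInr_apply hj] at hxy
      exact ⟨i, (Sum.inl_injective hxy).symm, rfl⟩
    · rw [sumInr_of_notMem hx] at hxy
      exact absurd hxy Sum.inl_ne_inr

open Classical in
/-- The labelling of the amalgamated union `Y ⊕ (R ∖ K)` given by the labelling `η` of `Y`, which
is a subset of some `Z` by `e`, and the labelling `ρ` of `R`: the label of an element of `K` is
taken from `R` if it is undefined in the labelling `κ` of `K`. -/
noncomputable def sumLabel (i : K → Z) (j : K → R) (e : Y → Z) (κ : K → Option α)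
    (η : Y → Option α) (ρ : R → Option α) : Y ⊕ {x : R // x ∉ Set.range j} → Option α :=
  Sum.elim (fun y => if h : ∃ x, κ x = none ∧ i x = e y then ρ (j h.choose) else η y)
    fun x => ρ x

namespace sumLabel

variable {k : K → Y} {i : K → Z} {j : K → R} {e : Y → Z} {κ : K → Option α} {η : Y → Option α}
  {ρ : R → Option α}

theorem inl_of_eq_none (hi : Function.Injective i) (he : ∀ x, e (k x) = i x) {x : K}
    (hx : κ x = none) : sumLabel i j e κ η ρ (.inl (k x)) = ρ (j x) := by
  have h : ∃ x', κ x' = none ∧ i x' = e (k x) := ⟨x, hx, (he x).symm⟩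
  exact (dif_pos h).trans (congrArg (fun x => ρ (j x)) (hi (h.choose_spec.2.trans (he x))))

theorem inl_eq_of_ne_none (hη : ∀ x, η (k x) = κ x) (he : Function.Injective e)
    (hk : ∀ x, e (k x) = i x) {y : Y} (hy : η y ≠ none) :
    sumLabel i j e κ η ρ (.inl y) = η y := by
  refine dif_neg ?_
  rintro ⟨x, hx, hxy⟩
  exact hy (by rw [← he ((hk x).trans hxy), hη, hx])

theorem sumInr_eq (hη : ∀ x, η (k x) = κ x) (hρ : ∀ x a, κ x = some a → ρ (j x) = some a)
    (hj : Function.Injective j) (hi : Function.Injective i) (he : Function.Injective e)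
    (hk : ∀ x, e (k x) = i x) (x : R) :
    sumLabel i j e κ η ρ (sumInr k j x) = ρ x := by
  by_cases hx : x ∈ Set.range j
  · obtain ⟨x, rfl⟩ := hx
    rw [sumInr_apply hj]
    cases hκ : κ x with
    | none => exact inl_of_eq_none hi hk hκ
    | some a => rw [inl_eq_of_ne_none hη he hk (by simp [hη, hκ]), hη, hκ, hρ x a hκ]
  · rw [sumInr_of_notMem hx]
    rfl

theorem labelsCover (hj : Function.Injective j) (he : Function.Injective e)
    (hk : ∀ x, e (k x) = i x) :
    LabelsCover .inl (sumInr k j) η ρ (sumLabel i j e κ η ρ) := by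
  rintro (y | x) a hz
  · by_cases h : ∃ x, κ x = none ∧ i x = e y
    · have hy : k h.choose = y := he ((hk _).trans h.choose_spec.2)
      exact .inr ⟨j h.choose, by rw [sumInr_apply hj, hy], (dif_pos h).symm.trans hz⟩
    · exact .inl ⟨y, rfl, (dif_neg h).symm.trans hz⟩
  · exact .inr ⟨x, sumInr_of_notMem x.2, hz⟩

end sumLabel

end

namespace Match

variable {r : Rule.{u, v, w} 𝓛} {G : TLRG.{u, v, w} 𝓛}

theorem ext {μ ν : Match r G} (h : μ.g = ν.g) : μ = ν := by
  cases μ; cases ν; cases h; rfl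

variable (μ : Match r G)

open Classical in
/-- The inclusion of the intermediate graph of a rule application. -/
noncomputable def inclusion : Hom μ.intermediate G.1 where
  V := Subtype.val
  E := Subtype.val
  source _ := rfl
  target _ := rfl
  edgeLabel _ := rfl
  nodeLabel y a h := by
    change ite _ _ _ = _ at h
    split_ifs at h
    exact h
  rootedness y a h := by
    change ite _ _ _ = _ at h
    split_ifs at h
    exact h

theorem inclusion_injective : μ.inclusion.Injective :=
  ⟨Subtype.val_injective, Subtype.val_injective⟩

theorem interface_injective : μ.interface.Injective := μ.injective.comp r.inL_injective

theorem isRemainder_inclusion : IsRemainder r.inL μ.g μ.inclusion where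
  injective := μ.inclusion_injective
  preserves :=
    { node := fun x y h => by_contra fun hx => y.2 ⟨x, hx, h⟩
      edge := fun x y h => by_contra fun hx => y.2 ⟨x, hx, h⟩
      label := fun k _ hk hl => if_pos ⟨k, hl, hk⟩
      root := fun k _ hk hl => if_pos ⟨k, hl, hk⟩ }
  node y hy := ⟨⟨y, fun ⟨x, hx, hxy⟩ => hx (hy x hxy)⟩, rfl⟩
  edge y hy := ⟨⟨y, fun ⟨x, hx, hxy⟩ => hx (hy x hxy)⟩, rfl⟩
  label _ _ h hk := (if_neg fun ⟨k, hl, hky⟩ => hk k hky hl).trans h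
  root _ _ h hk := (if_neg fun ⟨k, hl, hky⟩ => hk k hky hl).trans h

open Classical in
theorem intermediate_l_interface (k : r.K.V) :
    μ.intermediate.l ⟨μ.interface.V k, μ.interface_not_deleted k⟩ = r.K.l k := by
  change ite _ _ _ = _
  cases hk : r.K.l k with
  | none => exact if_pos ⟨k, hk, rfl⟩
  | some a =>
    refine (if_neg ?_).trans (μ.interface.nodeLabel k a hk)
    rintro ⟨k', hk', h⟩
    rw [μ.interface_injective.1 h, hk] at hk'
    exact Option.some_ne_none a hk'

open Classical in
theorem intermediate_p_interface (k : r.K.V) :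
    μ.intermediate.p ⟨μ.interface.V k, μ.interface_not_deleted k⟩ = r.K.p k := by
  change ite _ _ _ = _
  cases hk : r.K.p k with
  | none => exact if_pos ⟨k, hk, rfl⟩
  | some a =>
    refine (if_neg ?_).trans (μ.interface.rootedness k a hk)
    rintro ⟨k', hk', h⟩
    rw [μ.interface_injective.1 h, hk] at hk'
    exact Option.some_ne_none a hk'

/-- The inclusion of the interface of the rule into the intermediate graph. -/
noncomputable def interfaceLift : Hom r.K μ.intermediate where
  V k := ⟨μ.interface.V k, μ.interface_not_deleted k⟩
  E k := ⟨μ.interface.E k, fun ⟨_, hx, h⟩ => hx ⟨k, (μ.injective.2 h).symm⟩⟩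
  source k := Subtype.ext (μ.interface.source k)
  target k := Subtype.ext (μ.interface.target k)
  edgeLabel := μ.interface.edgeLabel
  nodeLabel k _ h := (μ.intermediate_l_interface k).trans h
  rootedness k _ h := (μ.intermediate_p_interface k).trans h

theorem interfaceLift_injective : μ.interfaceLift.Injective :=
  ⟨fun _ _ h => μ.interface_injective.1 (congrArg Subtype.val h),
    fun _ _ h => μ.interface_injective.2 (congrArg Subtype.val h)⟩

/-- The inclusion of the intermediate graph into the result graph. -/
noncomputable def resultInl : Hom μ.intermediate μ.result.1 where
  V := Sum.inl
  E := Sum.inl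
  source _ := rfl
  target _ := rfl
  edgeLabel _ := rfl
  nodeLabel _ a h := (sumLabel.inl_eq_of_ne_none (k := μ.interfaceLift.V) (i := μ.interface.V)
    μ.intermediate_l_interface Subtype.val_injective (fun _ => rfl)
    (h.trans_ne (Option.some_ne_none a))).trans h
  rootedness _ a h := (sumLabel.inl_eq_of_ne_none (k := μ.interfaceLift.V) (i := μ.interface.V)
    μ.intermediate_p_interface Subtype.val_injective (fun _ => rfl)
    (h.trans_ne (Option.some_ne_none a))).trans h

/-- The comatch: the inclusion of the right-hand side of the rule into the result graph. -/
noncomputable def comatch : Hom r.R.1 μ.result.1 where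
  V := sumInr μ.interfaceLift.V r.inR.V
  E := sumInr μ.interfaceLift.E r.inR.E
  source e := by
    by_cases he : e ∈ Set.range r.inR.E
    · obtain ⟨k, rfl⟩ := he
      rw [sumInr_apply r.inR_injective.2, ← r.inR.source, sumInr_apply r.inR_injective.1]
      exact congrArg Sum.inl (μ.interfaceLift.source k)
    · rw [sumInr_of_notMem he]; rfl
  target e := by
    by_cases he : e ∈ Set.range r.inR.E
    · obtain ⟨k, rfl⟩ := he
      rw [sumInr_apply r.inR_injective.2, ← r.inR.target, sumInr_apply r.inR_injective.1]
      exact congrArg Sum.inl (μ.interfaceLift.target k)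
    · rw [sumInr_of_notMem he]; rfl
  edgeLabel e := by
    by_cases he : e ∈ Set.range r.inR.E
    · obtain ⟨k, rfl⟩ := he
      rw [sumInr_apply r.inR_injective.2, ← r.inR.edgeLabel]
      exact μ.interfaceLift.edgeLabel k
    · rw [sumInr_of_notMem he]; rfl
  nodeLabel x a h := (sumLabel.sumInr_eq μ.intermediate_l_interface r.inR.nodeLabel
    r.inR_injective.1 μ.interface_injective.1 Subtype.val_injective (fun _ => rfl) x).trans h
  rootedness x a h := (sumLabel.sumInr_eq μ.intermediate_p_interface r.inR.rootedness
    r.inR_injective.1 μ.interface_injective.1 Subtype.val_injective (fun _ => rfl) x).trans h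

theorem isGluing_result : IsGluing μ.interfaceLift r.inR μ.resultInl μ.comatch where
  nodes := isAmalgam_sum μ.interfaceLift_injective.1 r.inR_injective.1
  edges := isAmalgam_sum μ.interfaceLift_injective.2 r.inR_injective.2
  labels := sumLabel.labelsCover r.inR_injective.1 Subtype.val_injective fun _ => rfl
  roots := sumLabel.labelsCover r.inR_injective.1 Subtype.val_injective fun _ => rfl

theorem comp_eq_of_interfaceLift {r' : Rule.{u, v, w} 𝓛} {μ : Match r G} {ν : Match r' G}
    {i : Hom P μ.intermediate} {j : Hom P ν.intermediate}
    (hij : μ.inclusion.comp i = ν.inclusion.comp j) {k : Hom r.K P}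
    (hk : i.comp k = μ.interfaceLift) {g : Hom r.L.1 ν.intermediate}
    (hg : ν.inclusion.comp g = μ.g) : j.comp k = g.comp r.inL :=
  ν.inclusion_injective.cancel_left <|
    calc (ν.inclusion.comp j).comp k
      _ = μ.inclusion.comp (i.comp k) := congrArg (Hom.comp · k) hij.symm
      _ = μ.interface := congrArg μ.inclusion.comp hk
      _ = (ν.inclusion.comp g).comp r.inL := congrArg (Hom.comp · r.inL) hg.symm

end Match

namespace DirectDerivation

variable {r : Rule.{u, v, w} 𝓛} {G H : TLRG.{u, v, w} 𝓛}

section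

variable (d : DirectDerivation r G H)

/-- The inclusion of the intermediate graph into the derived graph. -/
noncomputable def inl : Hom d.μ.intermediate H.1 := d.iso.hom.comp d.μ.resultInl

/-- The comatch: the inclusion of the right-hand side of the rule into the derived graph. -/
noncomputable def comatch : Hom r.R.1 H.1 := d.iso.hom.comp d.μ.comatch

theorem isGluing : IsGluing d.μ.interfaceLift r.inR d.inl d.comatch :=
  d.μ.isGluing_result.transport (Iso.refl _) d.iso

end

theorem nonempty_of_isGluing {μ : Match r G} {a : Hom μ.intermediate H.1} {s : Hom r.R.1 H.1}
    (h : IsGluing μ.interfaceLift r.inR a s) : Nonempty (DirectDerivation r G H) :=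
  (μ.isGluing_result.exists_iso h).elim fun φ _ => ⟨⟨μ, φ⟩⟩

end DirectDerivation

/-! ### Rule application to part of a gluing -/

namespace IsGluing

variable {b : Hom B X} {c : Hom B C}

theorem preserves_inr {p : Hom X G} {q : Hom C G} (h : IsGluing b c p q) {u : Hom K L}
    {g : Hom L X} (hb : Preserves u g b)
    (hl : ∀ k β, g.V (u.V k) = b.V β → K.l k = none → C.l (c.V β) = none)
    (hp : ∀ k β, g.V (u.V k) = b.V β → K.p k = none → C.p (c.V β) = none) :
    Preserves u (p.comp g) q where
  node _ _ hxy := by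
    obtain ⟨β, hβ, -⟩ := h.nodes.inter hxy
    exact hb.node _ β hβ.symm
  edge _ _ hxy := by
    obtain ⟨β, hβ, -⟩ := h.edges.inter hxy
    exact hb.edge _ β hβ.symm
  label k _ hky hk := by
    obtain ⟨β, hβ, rfl⟩ := h.nodes.inter hky
    exact hl k β hβ.symm hk
  root k _ hky hk := by
    obtain ⟨β, hβ, rfl⟩ := h.nodes.inter hky
    exact hp k β hβ.symm hk

variable {r : Rule.{u, v, w} 𝓛} {G H : TLRG.{u, v, w} 𝓛} {p : Hom X G.1} {q : Hom C G.1}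
  {g : Hom r.L.1 X} {e : Hom X' X}

theorem exists_match (h : IsGluing b c p q) (hg : g.Injective) (he : IsRemainder r.inL g e)
    (hq : Preserves r.inL (p.comp g) q) : ∃ μ : Match r G, μ.g = p.comp g := by
  refine ⟨⟨p.comp g, h.inl_injective.comp hg, fun z hz x hx => ?_⟩, rfl⟩
  obtain ⟨y, rfl⟩ | ⟨y, rfl⟩ := h.edges.cover z
  · obtain ⟨y, rfl⟩ := he.edge y fun x hxy => absurd ⟨x, congrArg p.E hxy⟩ hz
    exact ((Preserves.comp_left_iff h.inl_injective).2 he.preserves).source_ne_and_target_ne y hx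
  · exact hq.source_ne_and_target_ne y hx

/-- The application of `r` to `X` is given by `IsRemainder` and `IsGluing` rather than as a direct
derivation because `X` may be partially labelled, as intermediate graphs are. -/
theorem exists_of_directDerivation (h : IsGluing b c p q) (he : IsRemainder r.inL g e)
    {k : Hom r.K X'} (hk : e.comp k = g.comp r.inL) {a : Hom X' A} {s : Hom r.R.1 A}
    (hA : IsGluing k r.inR a s) (d : DirectDerivation r G H) (hd : d.μ.g = p.comp g)
    (hq : Preserves r.inL (p.comp g) q) :
    ∃ (b' : Hom B X') (t : Hom A H.1) (n : Hom C H.1),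
      e.comp b' = b ∧ IsGluing (a.comp b') c t n := by
  obtain ⟨b', p', q', hb', hp', h'⟩ := h.restrict he (hd ▸ d.μ.isRemainder_inclusion) hq
  have hk' : p'.comp k = d.μ.interfaceLift := d.μ.inclusion_injective.cancel_left <|
    calc d.μ.inclusion.comp (p'.comp k)
      _ = (p.comp e).comp k := congrArg (Hom.comp · k) hp'
      _ = (p.comp g).comp r.inL := congrArg p.comp hk
      _ = d.μ.g.comp r.inL := congrArg (Hom.comp · r.inL) hd.symm
  obtain ⟨t, ht⟩ := h'.interchange hA (hk' ▸ d.isGluing)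
  exact ⟨b', t, _, hb', ht⟩

end IsGluing

/-! ### Parallel independence -/

theorem DirectDerivation.exists_residual {r r' : Rule.{u, v, w} 𝓛} {G H : TLRG.{u, v, w} 𝓛}
    (d : DirectDerivation r G H) {μ : Match r' G} (h : Preserves r.inL d.μ.g μ.g)
    (h' : Preserves r'.inL μ.g d.μ.g) {i : Hom P d.μ.intermediate} {j : Hom P μ.intermediate}
    (hij : IsIntersection d.μ.inclusion μ.inclusion i j) :
    ∃ (g : Hom r'.L.1 d.μ.intermediate) (ν : Match r' H), d.μ.inclusion.comp g = μ.g ∧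
      ν.g = d.inl.comp g ∧ IsRemainder r'.inL g i ∧ Preserves r'.inL ν.g d.comatch := by
  obtain ⟨g, hg⟩ := d.μ.isRemainder_inclusion.exists_lift h
  have hi : IsRemainder r'.inL g i :=
    hij.isRemainder d.μ.inclusion_injective (hg ▸ μ.isRemainder_inclusion)
  have hgV := Hom.congr_V hg
  have hK : Preserves r'.inL g d.μ.interfaceLift :=
    (Preserves.comp_left_iff d.μ.inclusion_injective).1 (hg ▸ h'.comp r.inL)
  have hR : Preserves r'.inL (d.inl.comp g) d.comatch := by
    refine d.isGluing.preserves_inr hK (fun k β hkβ hk => ?_) fun k β hkβ hk => ?_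
    · exact absurd (h'.label k (r.inL.V β) ((hgV _).symm.trans (congrArg Subtype.val hkβ)) hk)
        (Option.isSome_iff_ne_none.1 (r.L.2.1 _))
    · exact absurd (h'.root k (r.inL.V β) ((hgV _).symm.trans (congrArg Subtype.val hkβ)) hk)
        (Option.isSome_iff_ne_none.1 (r.L.2.2 _))
  obtain ⟨ν, hν⟩ := d.isGluing.exists_match (.of_comp (hg ▸ μ.injective)) hi hR
  exact ⟨g, ν, hg, hν, hi, hν ▸ hR⟩

namespace Hom

variable {f : Hom A G}

theorem node_mem_image_iff {x : G.V} : Item.node x ∈ f.image ↔ ∃ y, f.V y = x := by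
  simp [image, eq_comm (a := x)]

theorem edge_mem_image_iff {e : G.E} : Item.edge e ∈ f.image ↔ ∃ y, f.E y = e := by
  simp [image, eq_comm (a := e)]

theorem label_mem_image_iff {x : G.V} :
    Item.label x ∈ f.image ↔ ∃ y, (A.l y).isSome ∧ f.V y = x := by
  simp [image, eq_comm (a := x)]

theorem root_mem_image_iff {x : G.V} :
    Item.root x ∈ f.image ↔ ∃ y, (A.p y).isSome ∧ f.V y = x := by
  simp [image, eq_comm (a := x)]

end Hom

namespace Preserves

variable {u : Hom K L} {g : Hom L G} {f : Hom A G}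

theorem image_inter_subset (h : Preserves u g f) : g.image ∩ f.image ⊆ (g.comp u).image := by
  rintro (y | y | y | y) ⟨hy, hy'⟩
  · obtain ⟨x, rfl⟩ := Hom.node_mem_image_iff.1 hy
    obtain ⟨z, hz⟩ := Hom.node_mem_image_iff.1 hy'
    obtain ⟨k, rfl⟩ := h.node x z hz.symm
    exact Hom.node_mem_image_iff.2 ⟨k, rfl⟩
  · obtain ⟨x, rfl⟩ := Hom.edge_mem_image_iff.1 hy
    obtain ⟨z, hz⟩ := Hom.edge_mem_image_iff.1 hy'
    obtain ⟨k, rfl⟩ := h.edge x z hz.symm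
    exact Hom.edge_mem_image_iff.2 ⟨k, rfl⟩
  · obtain ⟨x, -, rfl⟩ := Hom.label_mem_image_iff.1 hy
    obtain ⟨z, hz, hzx⟩ := Hom.label_mem_image_iff.1 hy'
    obtain ⟨k, rfl⟩ := h.node x z hzx.symm
    have hk : K.l k ≠ none := fun hk =>
      Option.isSome_iff_ne_none.1 hz (h.label k z hzx.symm hk)
    exact Hom.label_mem_image_iff.2 ⟨k, Option.isSome_iff_ne_none.2 hk, rfl⟩
  · obtain ⟨x, -, rfl⟩ := Hom.root_mem_image_iff.1 hy
    obtain ⟨z, hz, hzx⟩ := Hom.root_mem_image_iff.1 hy'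
    obtain ⟨k, rfl⟩ := h.node x z hzx.symm
    have hk : K.p k ≠ none := fun hk =>
      Option.isSome_iff_ne_none.1 hz (h.root k z hzx.symm hk)
    exact Hom.root_mem_image_iff.2 ⟨k, Option.isSome_iff_ne_none.2 hk, rfl⟩

theorem of_image_inter_subset (hL : L.IsTLRG) (hu : u.Injective) (hg : g.Injective)
    (h : g.image ∩ f.image ⊆ (g.comp u).image) : Preserves u g f where
  node x y hxy := by
    obtain ⟨k, hk⟩ := Hom.node_mem_image_iff.1
      (h ⟨Hom.node_mem_image_iff.2 ⟨x, hxy⟩, Hom.node_mem_image_iff.2 ⟨y, rfl⟩⟩)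
    exact ⟨k, hg.1 (hk.trans hxy.symm)⟩
  edge x y hxy := by
    obtain ⟨k, hk⟩ := Hom.edge_mem_image_iff.1
      (h ⟨Hom.edge_mem_image_iff.2 ⟨x, hxy⟩, Hom.edge_mem_image_iff.2 ⟨y, rfl⟩⟩)
    exact ⟨k, hg.2 (hk.trans hxy.symm)⟩
  label k y hky hk := by
    by_contra hy
    obtain ⟨k', hk', hk'y⟩ := Hom.label_mem_image_iff.1
      (h ⟨Hom.label_mem_image_iff.2 ⟨_, hL.1 _, hky⟩,
        Hom.label_mem_image_iff.2 ⟨y, Option.isSome_iff_ne_none.2 hy, rfl⟩⟩)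
    obtain rfl := hu.1 (hg.1 (hk'y.trans hky.symm))
    exact Option.isSome_iff_ne_none.1 hk' hk
  root k y hky hk := by
    by_contra hy
    obtain ⟨k', hk', hk'y⟩ := Hom.root_mem_image_iff.1
      (h ⟨Hom.root_mem_image_iff.2 ⟨_, hL.2 _, hky⟩,
        Hom.root_mem_image_iff.2 ⟨y, Option.isSome_iff_ne_none.2 hy, rfl⟩⟩)
    obtain rfl := hu.1 (hg.1 (hk'y.trans hky.symm))
    exact Option.isSome_iff_ne_none.1 hk' hk

end Preserves

namespace DerivationPair

variable {T : GTSystem.{u, v, w} 𝓛} {Φ : DerivationPair T}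

theorem parallelIndependent_iff : Φ.ParallelIndependent ↔
    Preserves Φ.r₁.inL Φ.d₁.μ.g Φ.d₂.μ.g ∧ Preserves Φ.r₂.inL Φ.d₂.μ.g Φ.d₁.μ.g := by
  refine Set.subset_inter_iff.trans (and_congr ⟨?_, Preserves.image_inter_subset⟩ ?_)
  · exact .of_image_inter_subset Φ.r₁.L.2 Φ.r₁.inL_injective Φ.d₁.μ.injective
  · rw [Set.inter_comm]
    exact ⟨.of_image_inter_subset Φ.r₂.L.2 Φ.r₂.inL_injective Φ.d₂.μ.injective,
      Preserves.image_inter_subset⟩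

/-- The Local Church–Rosser property: in either order, the two steps glue both right-hand sides to
the intersection of the two intermediate graphs. -/
theorem ParallelIndependent.joinable (h : Φ.ParallelIndependent) : T.Joinable Φ.H₁ Φ.H₂ := by
  obtain ⟨h₁, h₂⟩ := parallelIndependent_iff.1 h
  have hij := Hom.isIntersection_inter Φ.d₁.μ.inclusion_injective Φ.d₂.μ.inclusion_injective
  obtain ⟨g₂, ν₂, hg₂, hν₂, he₂, hq₂⟩ := Φ.d₁.exists_residual h₁ h₂ hij
  obtain ⟨g₁, ν₁, hg₁, hν₁, he₁, hq₁⟩ := Φ.d₂.exists_residual h₂ h₁ hij.flip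
  obtain ⟨k₁, a, s, hk₁, ha, hA⟩ :=
    Φ.d₁.isGluing.restrict he₂ (hν₂ ▸ ν₂.isRemainder_inclusion) (hν₂ ▸ hq₂)
  have hk := Match.comp_eq_of_interfaceLift hij.comm hk₁ hg₁
  let d : DirectDerivation Φ.r₁ Φ.H₂ ν₁.result := ⟨ν₁, Iso.refl _⟩
  obtain ⟨k₂, t, n, hk₂, hM⟩ :=
    Φ.d₂.isGluing.exists_of_directDerivation he₁ hk hA d hν₁ (hν₁ ▸ hq₁)
  have hk₂' : a.comp k₂ = ν₂.interfaceLift := ν₂.inclusion_injective.cancel_left <|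
    calc (ν₂.inclusion.comp a).comp k₂
      _ = (Φ.d₁.inl.comp _).comp k₂ := congrArg (Hom.comp · k₂) ha
      _ = Φ.d₁.inl.comp (g₂.comp Φ.r₂.inL) :=
        congrArg Φ.d₁.inl.comp (Match.comp_eq_of_interfaceLift hij.comm.symm hk₂ hg₂)
      _ = ν₂.interface := congrArg (Hom.comp · _) hν₂.symm
  obtain ⟨d'⟩ := DirectDerivation.nonempty_of_isGluing (hk₂' ▸ hM)
  exact ⟨ν₁.result, ⟨.step _ Φ.mem₂ d' (.iso (.refl _))⟩, ⟨.step _ Φ.mem₁ d (.iso (.refl _))⟩⟩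

end DerivationPair

/-! ### Embedding derivations -/

/-- The graph with node set `S` without edges, labels and rootedness. Gluing along such a graph
identifies nodes only. -/
def PLRG.discrete (𝓛 : LabelAlphabet.{u, v}) (S : Type w) [Finite S] : PLRG.{u, v, w} 𝓛 where
  V := S
  E := PEmpty
  finite_V := inferInstance
  finite_E := inferInstance
  s := PEmpty.elim
  t := PEmpty.elim
  l _ := none
  m := PEmpty.elim
  p _ := none

/-- A family of nodes of a graph, as a morphism. -/
def Hom.ofNodes {S : Type w} [Finite S] (f : S → G.V) : Hom (PLRG.discrete 𝓛 S) G where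
  V := f
  E := PEmpty.elim
  source e := e.elim
  target e := e.elim
  edgeLabel e := e.elim
  nodeLabel _ _ h := (Option.some_ne_none _ h.symm).elim
  rootedness _ _ h := (Option.some_ne_none _ h.symm).elim

section Embedding

variable {S : Type w} [Finite S]

theorem Hom.ofNodes_eq {f : S → G.V} {g : Hom (PLRG.discrete 𝓛 S) G} (h : ∀ β, f β = g.V β) :
    Hom.ofNodes f = g :=
  Hom.ext (funext h) (funext fun e => e.elim)

/-- `G` arises from `X` by attaching a context `C` at the nodes `f`, where the context provides
neither labels nor rootedness for these nodes. -/
structure IsAttachment (f : S → X.V) (c : S → C.V) (p : Hom X G) (q : Hom C G) : Prop where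
  isGluing : IsGluing (.ofNodes f) (.ofNodes c) p q
  label : ∀ β, C.l (c β) = none
  root : ∀ β, C.p (c β) = none

namespace IsAttachment

variable {r : Rule.{u, v, w} 𝓛} {F F' G H : TLRG.{u, v, w} 𝓛} {f : S → F.1.V} {c : S → C.V}
  {p : Hom F.1 G.1} {q : Hom C G.1}

theorem preserves (h : IsAttachment f c p q) (μ : Match r F) (hf : ∀ β, f β ∉ μ.deletedV) :
    Preserves r.inL (p.comp μ.g) q :=
  h.isGluing.preserves_inr
    ⟨fun x β hx => by_contra fun hn => hf β ⟨x, hn, hx⟩, fun _ e => e.elim,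
      fun _ _ _ _ => rfl, fun _ _ _ _ => rfl⟩ (fun _ β _ _ => h.label β) fun _ β _ _ => h.root β

theorem exists_match (h : IsAttachment f c p q) (μ : Match r F) (hf : ∀ β, f β ∉ μ.deletedV) :
    ∃ ν : Match r G, ν.g = p.comp μ.g :=
  h.isGluing.exists_match μ.injective μ.isRemainder_inclusion (h.preserves μ hf)

theorem exists_of_directDerivation (h : IsAttachment f c p q) (d : DirectDerivation r F F')
    (d' : DirectDerivation r G H) (hd : d'.μ.g = p.comp d.μ.g) {f' : S → F'.1.V}
    (hf : ∀ β, f' β ∈ d.track (f β)) :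
    ∃ (t : Hom F'.1 H.1) (n : Hom C H.1), IsAttachment f' c t n := by
  obtain ⟨b, t, n, hb, hG⟩ := h.isGluing.exists_of_directDerivation d.μ.isRemainder_inclusion
    (k := d.μ.interfaceLift) rfl d.isGluing d' hd (h.preserves d.μ fun β => (hf β).1)
  have hf' : Hom.ofNodes f' = d.inl.comp b := Hom.ofNodes_eq fun β => by
    obtain ⟨hβ, hβ'⟩ := hf β
    exact hβ'.symm.trans (congrArg d.inl.V (Subtype.ext (Hom.congr_V hb β).symm))
  exact ⟨t, n, hf' ▸ hG, h.label, h.root⟩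

variable {T : GTSystem.{u, v, w} 𝓛}

theorem exists_derivation {F F' : TLRG.{u, v, w} 𝓛} (δ : Derivation T F F') :
    ∀ {G : TLRG.{u, v, w} 𝓛} {f : S → F.1.V} {p : Hom F.1 G.1} {q : Hom C G.1} {f' : S → F'.1.V},
      IsAttachment f c p q → (∀ β, f' β ∈ δ.track (f β)) →
        ∃ (H : TLRG.{u, v, w} 𝓛) (t : Hom F'.1 H.1) (n : Hom C H.1),
          Nonempty (Derivation T G H) ∧ IsAttachment f' c t n := by
  induction δ with
  | iso φ =>
    intro G f p q f' h hf
    have hf' : Hom.ofNodes f' = φ.hom.comp (Hom.ofNodes f) :=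
      Hom.ofNodes_eq fun β => Part.mem_some_iff.1 (hf β)
    exact ⟨G, _, _, ⟨.iso (.refl _)⟩, hf' ▸ h.isGluing.transport φ (.refl _), h.label, h.root⟩
  | step r hr d δ ih =>
    intro G f p q f' h hf
    choose f₁ hf₁ hf' using fun β => Part.mem_bind_iff.1 (hf β)
    obtain ⟨μ, hμ⟩ := h.exists_match d.μ fun β => (hf₁ β).1
    let d' : DirectDerivation r G μ.result := ⟨μ, Iso.refl _⟩
    obtain ⟨t, n, h'⟩ := h.exists_of_directDerivation d d' hμ hf₁
    obtain ⟨H, t', n', ⟨δ'⟩, hH⟩ := ih h' hf'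
    exact ⟨H, t', n', ⟨.step r hr d' δ'⟩, hH⟩

theorem exists_derivation_of_directDerivation (h : IsAttachment f c p q)
    {d : DirectDerivation r F F'} {d' : DirectDerivation r G H} (hd : d'.μ.g = p.comp d.μ.g)
    {M : TLRG.{u, v, w} 𝓛} {δ : Derivation T F' M} {f' : S → M.1.V}
    (hf : ∀ β, f' β ∈ (δ.track.comp d.track) (f β)) :
    ∃ (N : TLRG.{u, v, w} 𝓛) (t : Hom M.1 N.1) (n : Hom C N.1),
      Nonempty (Derivation T H N) ∧ IsAttachment f' c t n := by
  choose f₁ hf₁ hf' using fun β => Part.mem_bind_iff.1 (hf β)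
  obtain ⟨t, n, h'⟩ := h.exists_of_directDerivation d d' hd hf₁
  exact exists_derivation δ h' hf'

end IsAttachment

open Classical in
/-- The context of the part `ι : X → G` of `G` with boundary `f`: it consists of everything outside
`X` and of the boundary nodes, which are given neither labels nor rootedness. -/
noncomputable def Hom.context (ι : Hom X G) (f : S → X.V)
    (hf : ∀ e ∉ Set.range ι.E, ∀ x, G.s e = ι.V x ∨ G.t e = ι.V x → x ∈ Set.range f) :
    PLRG.{u, v, w} 𝓛 where
  V := {y : G.V // ∀ x, y = ι.V x → x ∈ Set.range f}
  E := {e : G.E // e ∉ Set.range ι.E}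
  finite_V := haveI := G.finite_V; inferInstance
  finite_E := haveI := G.finite_E; inferInstance
  s e := ⟨G.s e, fun x hx => hf e e.2 x (.inl hx)⟩
  t e := ⟨G.t e, fun x hx => hf e e.2 x (.inr hx)⟩
  l y := if ∃ x, ι.V x = y then none else G.l y
  m e := G.m e
  p y := if ∃ x, ι.V x = y then none else G.p y

open Classical in
/-- The inclusion of the context of a part of `G` into `G`. -/
noncomputable def Hom.contextInclusion (ι : Hom X G) (f : S → X.V)
    (hf : ∀ e ∉ Set.range ι.E, ∀ x, G.s e = ι.V x ∨ G.t e = ι.V x → x ∈ Set.range f) :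
    Hom (ι.context f hf) G where
  V := Subtype.val
  E := Subtype.val
  source _ := rfl
  target _ := rfl
  edgeLabel _ := rfl
  nodeLabel y a h := by
    change ite _ _ _ = _ at h
    split_ifs at h
    exact h
  rootedness y a h := by
    change ite _ _ _ = _ at h
    split_ifs at h
    exact h

open Classical in
theorem LabelsCover.of_complement {X Z : Type w} {α : Type*} {p : X → Z} {P : Z → Prop}
    {ξ : X → Option α} {ζ : Z → Option α} (hP : ∀ z, (¬∃ x, p x = z) → P z)
    (hξ : ∀ x, ξ x = ζ (p x)) :
    LabelsCover p (Subtype.val : {z // P z} → Z) ξ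
      (fun z => if ∃ x, p x = z then none else ζ z) ζ := fun z a hz => by
  by_cases hx : ∃ x, p x = z
  · obtain ⟨x, rfl⟩ := hx
    exact .inl ⟨x, rfl, (hξ x).trans hz⟩
  · exact .inr ⟨⟨z, hP z hx⟩, rfl, (if_neg hx).trans hz⟩

theorem Hom.isAttachment_context {ι : Hom X G} (hι : ι.Injective)
    (hι' : ι.UndefinednessPreserving) {f : S → X.V} (hf : Function.Injective f)
    (hb : ∀ e ∉ Set.range ι.E, ∀ x, G.s e = ι.V x ∨ G.t e = ι.V x → x ∈ Set.range f) :
    IsAttachment (C := ι.context f hb) f (fun β => ⟨ι.V (f β), fun _ hx => ⟨β, hι.1 hx⟩⟩) ι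
      (ι.contextInclusion f hb) := by
  have hc : ∀ z, (¬∃ x, ι.V x = z) → ∀ x, z = ι.V x → x ∈ Set.range f :=
    fun z hz x hx => absurd ⟨x, hx.symm⟩ hz
  refine ⟨⟨.of_jointly_surjective hι.1 Subtype.val_injective hf (fun _ => rfl) ?_ fun z => ?_,
    .of_jointly_surjective hι.2 Subtype.val_injective (fun e => e.elim) (fun e => e.elim) ?_
      fun z => ?_, .of_complement hc hι'.1, .of_complement hc hι'.2⟩,
    fun β => if_pos ⟨_, rfl⟩, fun β => if_pos ⟨_, rfl⟩⟩
  · intro x y hxy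
    obtain ⟨β, rfl⟩ := y.2 x hxy.symm
    exact ⟨β, rfl, Subtype.ext hxy⟩
  · exact (Classical.em (∃ x, ι.V x = z)).imp_right fun hz => ⟨⟨z, hc z hz⟩, rfl⟩
  · exact fun x y hxy => absurd ⟨x, hxy⟩ y.2
  · exact (Classical.em (z ∈ Set.range ι.E)).imp_right fun hz => ⟨⟨z, hz⟩, rfl⟩

end Embedding

/-! ### Restriction to the union of two matches -/

/-- The union of the images of `f` and `g`, with the labels and rootedness of `G`. -/
def Hom.union (f : Hom A G) (g : Hom B G) : PLRG.{u, v, w} 𝓛 where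
  V := ↥(Set.range f.V ∪ Set.range g.V)
  E := ↥(Set.range f.E ∪ Set.range g.E)
  finite_V := haveI := G.finite_V; inferInstance
  finite_E := haveI := G.finite_E; inferInstance
  s e := ⟨G.s e, e.2.imp (fun ⟨y, hy⟩ => ⟨_, (f.source y).trans (congrArg G.s hy)⟩)
    fun ⟨y, hy⟩ => ⟨_, (g.source y).trans (congrArg G.s hy)⟩⟩
  t e := ⟨G.t e, e.2.imp (fun ⟨y, hy⟩ => ⟨_, (f.target y).trans (congrArg G.t hy)⟩)
    fun ⟨y, hy⟩ => ⟨_, (g.target y).trans (congrArg G.t hy)⟩⟩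
  l x := G.l x
  m e := G.m e
  p x := G.p x

/-- The inclusion of the union of two images. -/
def Hom.unionInclusion (f : Hom A G) (g : Hom B G) : Hom (f.union g) G where
  V := Subtype.val
  E := Subtype.val
  source _ := rfl
  target _ := rfl
  edgeLabel _ := rfl
  nodeLabel _ _ h := h
  rootedness _ _ h := h

theorem Hom.exists_lift_union (f : Hom A G) (g : Hom B G) :
    ∃ (f' : Hom A (f.union g)) (g' : Hom B (f.union g)),
      (f.unionInclusion g).comp f' = f ∧ (f.unionInclusion g).comp g' = g :=
  ⟨⟨fun x => ⟨f.V x, .inl ⟨x, rfl⟩⟩, fun e => ⟨f.E e, .inl ⟨e, rfl⟩⟩,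
      fun e => Subtype.ext (f.source e), fun e => Subtype.ext (f.target e), f.edgeLabel,
      f.nodeLabel, f.rootedness⟩,
    ⟨fun x => ⟨g.V x, .inr ⟨x, rfl⟩⟩, fun e => ⟨g.E e, .inr ⟨e, rfl⟩⟩,
      fun e => Subtype.ext (g.source e), fun e => Subtype.ext (g.target e), g.edgeLabel,
      g.nodeLabel, g.rootedness⟩, rfl, rfl⟩

theorem PLRG.items_eq_image_union_image {f : Hom A G} {g : Hom B G} (hG : G.IsTLRG)
    (hA : A.IsTLRG) (hB : B.IsTLRG) (nodes : ∀ x, x ∈ Set.range f.V ∪ Set.range g.V)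
    (edges : ∀ e, e ∈ Set.range f.E ∪ Set.range g.E) : G.items = f.image ∪ g.image := by
  have hG' : G.items = Set.univ := by
    refine Set.eq_univ_of_forall fun i => ?_
    cases i with
    | node x => exact Hom.node_mem_image_iff.2 ⟨x, rfl⟩
    | edge e => exact Hom.edge_mem_image_iff.2 ⟨e, rfl⟩
    | label x => exact Hom.label_mem_image_iff.2 ⟨x, hG.1 x, rfl⟩
    | root x => exact Hom.root_mem_image_iff.2 ⟨x, hG.2 x, rfl⟩
  refine hG'.trans (Set.eq_univ_of_forall fun i => ?_).symm
  cases i with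
  | node x => exact (nodes x).imp Hom.node_mem_image_iff.2 Hom.node_mem_image_iff.2
  | edge e => exact (edges e).imp Hom.edge_mem_image_iff.2 Hom.edge_mem_image_iff.2
  | label x =>
    exact Or.imp (fun ⟨y, hy⟩ => Hom.label_mem_image_iff.2 ⟨y, hA.1 y, hy⟩)
      (fun ⟨y, hy⟩ => Hom.label_mem_image_iff.2 ⟨y, hB.1 y, hy⟩) (nodes x)
  | root x =>
    exact Or.imp (fun ⟨y, hy⟩ => Hom.root_mem_image_iff.2 ⟨y, hA.2 y, hy⟩)
      (fun ⟨y, hy⟩ => Hom.root_mem_image_iff.2 ⟨y, hB.2 y, hy⟩) (nodes x)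

/-- A match that factors through a subgraph, as a match in that subgraph. -/
def Match.restrict {r : Rule.{u, v, w} 𝓛} {F G : TLRG.{u, v, w} 𝓛} (μ : Match r G)
    {ι : Hom F.1 G.1} (hι : ι.Injective) {g : Hom r.L.1 F.1} (hg : ι.comp g = μ.g) : Match r F where
  g := g
  injective := .of_comp (hg ▸ μ.injective)
  dangling e he x hx := by
    have hgV : ι.V (g.V x) = μ.g.V x := Hom.congr_V hg x
    have hd := μ.dangling (ι.E e) (fun ⟨y, hy⟩ => he ⟨y, hι.2 ((Hom.congr_E hg y).trans hy)⟩) x hx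
    rw [← ι.source, ← ι.target, ← hgV] at hd
    exact ⟨fun h => hd.1 (congrArg ι.V h), fun h => hd.2 (congrArg ι.V h)⟩

theorem Match.sigma_eq_iff {r r' : Rule.{u, v, w} 𝓛} {G : TLRG.{u, v, w} 𝓛} {μ : Match r G}
    {ν : Match r' G} : (⟨r, μ⟩ : Σ r, Match r G) = ⟨r', ν⟩ ↔
      (⟨r, μ.g⟩ : Σ r : Rule.{u, v, w} 𝓛, Hom r.L.1 G.1) = ⟨r', ν.g⟩ where
  mp h := congrArg (fun x : Σ r, Match r G => (⟨x.1, x.2.g⟩ : Σ r : Rule _, Hom r.L.1 G.1)) h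
  mpr h := by
    obtain ⟨rfl, h⟩ := Sigma.mk.inj_iff.1 h
    rw [Match.ext (eq_of_heq h)]

theorem DirectDerivation.nonempty_iso_of_sigma_eq {r r' : Rule.{u, v, w} 𝓛}
    {G H H' : TLRG.{u, v, w} 𝓛} {d : DirectDerivation r G H} {d' : DirectDerivation r' G H'}
    (h : (⟨r, d.μ⟩ : Σ r, Match r G) = ⟨r', d'.μ⟩) : Nonempty (Iso H.1 H'.1) := by
  have hr : d.μ.result = d'.μ.result := congrArg (fun x : Σ r, Match r G => x.2.result) h
  exact ⟨d.iso.symm.trans ((hr ▸ Iso.refl _ : Iso d.μ.result.1 d'.μ.result.1).trans d'.iso)⟩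

namespace DerivationPair

variable {T : GTSystem.{u, v, w} 𝓛} {Φ : DerivationPair T}

/-- A subgraph `F` of the source graph of `Φ` through which the matches of both steps factor. -/
structure Restriction (Φ : DerivationPair T) where
  F : TLRG.{u, v, w} 𝓛
  ι : Hom F.1 Φ.G.1
  μ₁ : Match Φ.r₁ F
  μ₂ : Match Φ.r₂ F
  injective : ι.Injective
  undefinednessPreserving : ι.UndefinednessPreserving
  comp₁ : ι.comp μ₁.g = Φ.d₁.μ.g
  comp₂ : ι.comp μ₂.g = Φ.d₂.μ.g

namespace Restriction

/-- The restricted pair of direct derivations, which start from the subgraph. -/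
noncomputable def pair (ρ : Φ.Restriction) : DerivationPair T :=
  ⟨ρ.F, ρ.μ₁.result, ρ.μ₂.result, Φ.r₁, Φ.r₂, Φ.mem₁, Φ.mem₂, ⟨ρ.μ₁, .refl _⟩, ⟨ρ.μ₂, .refl _⟩⟩

theorem parallelIndependent_of_pair (ρ : Φ.Restriction) (h : ρ.pair.ParallelIndependent) :
    Φ.ParallelIndependent := by
  rw [parallelIndependent_iff] at h ⊢
  rw [← ρ.comp₁, ← ρ.comp₂]
  exact ⟨(Preserves.comp_left_iff ρ.injective).2 h.1, (Preserves.comp_left_iff ρ.injective).2 h.2⟩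

theorem sigma_match_eq (ρ : Φ.Restriction)
    (h : (⟨Φ.r₁, ρ.μ₁⟩ : Σ r, Match r ρ.F) = ⟨Φ.r₂, ρ.μ₂⟩) :
    (⟨Φ.r₁, Φ.d₁.μ⟩ : Σ r, Match r Φ.G) = ⟨Φ.r₂, Φ.d₂.μ⟩ := by
  rw [Match.sigma_eq_iff] at h ⊢
  rw [← ρ.comp₁, ← ρ.comp₂]
  exact congrArg (fun x : Σ r : Rule _, Hom r.L.1 ρ.F.1 =>
    (⟨x.1, ρ.ι.comp x.2⟩ : Σ r : Rule _, Hom r.L.1 Φ.G.1)) h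

end Restriction

theorem exists_restriction_isCritical (hΦ : ¬ Φ.ParallelIndependent)
    (hne : (⟨Φ.r₁, Φ.d₁.μ⟩ : Σ r, Match r Φ.G) ≠ ⟨Φ.r₂, Φ.d₂.μ⟩) :
    ∃ ρ : Φ.Restriction, ρ.pair.IsCritical := by
  let F : TLRG.{u, v, w} 𝓛 :=
    ⟨Φ.d₁.μ.g.union Φ.d₂.μ.g, fun x => Φ.G.2.1 x.1, fun x => Φ.G.2.2 x.1⟩
  let ι : Hom F.1 Φ.G.1 := Φ.d₁.μ.g.unionInclusion Φ.d₂.μ.g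
  have hι : ι.Injective := ⟨Subtype.val_injective, Subtype.val_injective⟩
  obtain ⟨g₁, g₂, hg₁, hg₂⟩ := Φ.d₁.μ.g.exists_lift_union Φ.d₂.μ.g
  let ρ : Φ.Restriction := ⟨F, ι, Φ.d₁.μ.restrict hι hg₁, Φ.d₂.μ.restrict hι hg₂, hι,
    ⟨fun _ => rfl, fun _ => rfl⟩, hg₁, hg₂⟩
  have cover : F.1.items = g₁.image ∪ g₂.image :=
    PLRG.items_eq_image_union_image F.2 Φ.r₁.L.2 Φ.r₂.L.2
      (fun x => Or.imp (fun ⟨y, hy⟩ => ⟨y, hι.1 ((Hom.congr_V hg₁ y).trans hy)⟩)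
        (fun ⟨y, hy⟩ => ⟨y, hι.1 ((Hom.congr_V hg₂ y).trans hy)⟩) x.2)
      (fun e => Or.imp (fun ⟨y, hy⟩ => ⟨y, hι.2 ((Hom.congr_E hg₁ y).trans hy)⟩)
        (fun ⟨y, hy⟩ => ⟨y, hι.2 ((Hom.congr_E hg₂ y).trans hy)⟩) e.2)
  exact ⟨ρ, cover, fun h => hΦ (ρ.parallelIndependent_of_pair h), fun h => hne (ρ.sigma_match_eq h)⟩

end DerivationPair

/-! ### Extending the joining derivations of a critical pair -/

/-- A derivation followed by an isomorphism of its result. -/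
def Derivation.transIso {T : GTSystem.{u, v, w} 𝓛} {G M N : TLRG.{u, v, w} 𝓛} :
    Derivation T G M → Iso M.1 N.1 → Derivation T G N
  | .iso φ, ψ => .iso (φ.trans ψ)
  | .step r hr d δ, ψ => .step r hr d (δ.transIso ψ)

theorem TLRG.cls_mem_subgraphClosure {D : Set (AbstractTLRG.{u, v, w} 𝓛)}
    {F G : TLRG.{u, v, w} 𝓛} (hF : IsSubgraph F.1 G.1) (hG : G.cls ∈ D) :
    F.cls ∈ subgraphClosure D :=
  fun _ ⟨hD, hS⟩ => hS G F hF (hD hG)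

namespace DerivationPair.Restriction

variable {T : GTSystem.{u, v, w} 𝓛} {Φ : DerivationPair T}

theorem mem_persist_of_incident (ρ : Φ.Restriction) {e : Φ.G.1.E} (he : e ∉ Set.range ρ.ι.E)
    {x : ρ.F.1.V} (hx : Φ.G.1.s e = ρ.ι.V x ∨ Φ.G.1.t e = ρ.ι.V x) : x ∈ ρ.pair.persist := by
  have not_deleted {r : Rule.{u, v, w} 𝓛} {μ : Match r ρ.F} {ν : Match r Φ.G}
      (hν : ρ.ι.comp μ.g = ν.g) : x ∉ μ.deletedV := by
    rintro ⟨y, hy, rfl⟩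
    obtain ⟨hs, ht⟩ := ν.dangling e (fun ⟨z, hz⟩ => he ⟨_, (Hom.congr_E hν z).trans hz⟩) y hy
    exact hx.elim (fun h => hs (h.trans (Hom.congr_V hν y)))
      fun h => ht (h.trans (Hom.congr_V hν y))
  exact ⟨not_deleted ρ.comp₁, not_deleted ρ.comp₂⟩

theorem joinable_of_stronglyJoinable (ρ : Φ.Restriction) (h : ρ.pair.StronglyJoinable) :
    T.Joinable Φ.H₁ Φ.H₂ := by
  obtain ⟨M, δ₁, δ₂, hδ⟩ := h
  have : Finite ρ.pair.G.1.V := ρ.F.1.finite_V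
  let f : ρ.pair.persist → ρ.F.1.V := Subtype.val
  have hG := Hom.isAttachment_context ρ.injective ρ.undefinednessPreserving (f := f)
    Subtype.val_injective fun e he x hx => ⟨⟨x, ρ.mem_persist_of_incident he hx⟩, rfl⟩
  let f' : ρ.pair.persist → M.1.V := fun β => Part.get _ (hδ β β.2).2
  have hf₁ : ∀ β, f' β ∈ (δ₁.track.comp ρ.pair.d₁.track) (f β) := fun β => Part.get_mem _
  have hf₂ : ∀ β, f' β ∈ (δ₂.track.comp ρ.pair.d₂.track) (f β) :=
    fun β => (hδ β β.2).1 ▸ hf₁ β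
  obtain ⟨N₁, t₁, n₁, ⟨ε₁⟩, hN₁⟩ :=
    hG.exists_derivation_of_directDerivation (d' := Φ.d₁) ρ.comp₁.symm hf₁
  obtain ⟨N₂, t₂, n₂, ⟨ε₂⟩, hN₂⟩ :=
    hG.exists_derivation_of_directDerivation (d' := Φ.d₂) ρ.comp₂.symm hf₂
  obtain ⟨φ, -⟩ := hN₁.isGluing.exists_iso hN₂.isGluing
  exact ⟨N₂, ⟨ε₁.transIso φ⟩, ⟨ε₂⟩⟩

end DerivationPair.Restriction

end Graphs
end RGT

theorem mainTheorem5 (𝓛 : RGT.LabelAlphabet.{u, v}) (T : RGT.GTSystem.{u, v, w} 𝓛)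
    (D : Set (RGT.AbstractTLRG.{u, v, w} 𝓛))
    (h : ∀ Φ : RGT.DerivationPair T, Φ.IsCritical → Φ.NonGarbage D → Φ.StronglyJoinable) :
    T.LocallyConfluentOn D := by
  rintro G H₁ H₂ hG ⟨r₁, hr₁, ⟨d₁⟩⟩ ⟨r₂, hr₂, ⟨d₂⟩⟩
  let Φ : RGT.DerivationPair T := ⟨G, H₁, H₂, r₁, r₂, hr₁, hr₂, d₁, d₂⟩
  by_cases hind : Φ.ParallelIndependent
  · exact hind.joinable
  by_cases heq : (⟨r₁, d₁.μ⟩ : Σ r, RGT.Match r G) = ⟨r₂, d₂.μ⟩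
  · obtain ⟨φ⟩ := RGT.DirectDerivation.nonempty_iso_of_sigma_eq heq
    exact ⟨H₂, ⟨.iso φ⟩, ⟨.iso (.refl _)⟩⟩
  obtain ⟨ρ, hρ⟩ := Φ.exists_restriction_isCritical hind heq
  have hF : RGT.IsSubgraph ρ.F.1 G.1 := ⟨ρ.ι, ρ.injective, ρ.undefinednessPreserving⟩
  exact ρ.joinable_of_stronglyJoinable (h ρ.pair hρ (RGT.TLRG.cls_mem_subgraphClosure hF hG))
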